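/- **Setting.** Fix $r>0$ and $n,m\in\mathbb{N}$, and let $\mathbb{R}^+=[0,\infty)$; $\|\cdot\|$ is the Euclidean norm. A function on an interval is *piecewise right-continuous* ($\mathcal{PC}$) if it is right-continuous, has left limits, and has finitely many discontinuities in each compact subinterval. Let $\mathcal{PC}=\mathcal{PC}([-r,0],\mathbb{R}^n)$ with $\|\varphi\|_r=\sup_{s\in[-r,0]}\|\varphi(s)\|$, and $x_t(s)=x(t+s)$ for $s\in[-r,0]$. Consider $$\dot x(t)=f(t,x_t,w(t))\ (t\neq t_k),\qquad x(t_k)-x(t_k^-)=I_k(t_k,x_{t_k^-},w(t_k^-))\ (k\ge 1),\qquad x_{t_0}=\varphi ,$$ where $t_0\ge 0$, $\varphi\in\mathcal{PC}$, $w\in\mathcal{PC}([t_0,\infty),\mathbb{R}^m)$, $t_0<t_1<t_2<\dots\to\infty$, $x_{t^-}(s)=x(t+s)$ for $s\in[-r,0)$, $x_{t^-}(0)=x(t^-)$, and $\dot x$ is the right-hand derivative. Here $f,I_k:\mathbb{R}^+\times\mathcal{PC}\times\mathbb{R}^m\to\mathbb{R}^n$ satisfy $f(t,0,0)=I_k(t,0,0)=0$,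 and for all $t_0\ge0$ and $w\in\mathcal{PC}([t_0,\infty),\mathbb{R}^m)$ the map $g(t,\phi)=f(t,\phi,w(t))$ is such that $t\mapsto g(t,x_t)$ is in $\mathcal{PC}([t_0,\infty),\mathbb{R}^n)$ for each $x\in\mathcal{PC}([t_0-r,\infty),\mathbb{R}^n)$, and $g$ is Lipschitz in $\phi$ on bounded subsets of $\mathcal{PC}$, uniformly for $t$ in compact subintervals of $[t_0,\infty)$. $\mathcal{K}_\infty$ is the class of continuous, strictly increasing, unbounded $\alpha:\mathbb{R}^+\to\mathbb{R}^+$ with $\alpha(0)=0$; $\mathcal{KL}$ is the class of continuous $\beta:\mathbb{R}^+\times\mathbb{R}^+\to\mathbb{R}^+$ such that $\beta(\cdot,t)$ is continuous, strictly increasing and zero at $0$ for each $t$, and $\beta(s,t)$ decreases (weakly) to $0$ as $t\to\infty$ for each $s$. Let $\ell_{\inf}(\delta)$ be the class of impulse sequences with $t_k-t_{k-1}\ge\delta$ for all $k\ge1$. The system is *uniformly iISS over* $\ell_{\inf}(\delta)$ if there are $\beta\in\mathcal{KL}$ and $\alpha,\gamma\in\mathcal{K}_\infty$ such that for all $t_0\ge0$,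 all sequences in $\ell_{\inf}(\delta)$, all $\varphi\in\mathcal{PC}$ and all $w\in\mathcal{PC}([t_0,\infty),\mathbb{R}^m)$, the (unique) solution exists on $[t_0-r,\infty)$ and $$\alpha(\|x(t)\|)\le\beta(\|\varphi\|_r,t-t_0)+\int_{t_0}^t\gamma(\|w(s)\|)\,ds+\sum_{t_0<t_k\le t}\gamma(\|w(t_k^-)\|)\qquad(t\ge t_0).$$ **Theorem.** Let $V_1:[-r,\infty)\times\mathbb{R}^n\to\mathbb{R}^+$ be such that for each $x\in\mathcal{PC}(\mathbb{R}^+,\mathbb{R}^n)$ the map $t\mapsto V_1(t,x(t))$ is piecewise right-continuous on $\mathbb{R}^+$ and discontinuous only where $x$ is. Let $V_2:\mathbb{R}^+\times\mathcal{PC}\to\mathbb{R}$ be such that $t\mapsto V_2(t,x_t)$ is continuous on $\mathbb{R}^+$ for each $x\in\mathcal{PC}([-r,\infty),\mathbb{R}^n)$. Let $\alpha_1,\alpha_2,\alpha_3,\chi\in\mathcal{K}_\infty$, $\mu>0$, $\rho_1,\rho_2\ge0$, $\delta\in\mathbb{R}$, and put $V(t,\phi)=V_1(t,\phi(0))+V_2(t,\phi)$.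 Suppose that for all $t\in\mathbb{R}^+$, $x\in\mathbb{R}^n$, $y\in\mathbb{R}^m$, $\phi\in\mathcal{PC}$ and $k\ge1$: (i) $\alpha_1(\|x\|)\le V_1(t,x)\le\alpha_2(\|x\|)$ (also for $t\in[-r,0)$) and $0\le V_2(t,\phi)\le\alpha_3(\|\phi\|_r)$; (ii) for every $w\in\mathcal{PC}([t,\infty),\mathbb{R}^m)$ and every solution $z$ of $\dot z(s)=f(s,z_s,w(s))$ on some interval $[t,b)$, $b>t$, with $z_t=\phi$, $$D^+V(t,\phi):=\limsup_{h\to0^+}\tfrac1h\big[V(t+h,z_{t+h})-V(t,\phi)\big]\le(\chi(\|w(t)\|)-\mu)V(t,\phi)+\chi(\|w(t)\|);$$ (iii) $V_1(t,\phi(0)+I_k(t,\phi,y))\le\rho_1V_1(t,\phi(0))+\rho_2\sup_{s\in[-r,0]}V_1(t+s,\phi(s))+\chi(\|y\|)$. Suppose moreover that one of the following holds: (a) $\rho_1\ge1$ and $\ln(\rho_1+\rho_2e^{\mu r})<\mu\delta$; (b) $\rho_1<1$, $\rho_1+\rho_2\ge1$, and there is $\kappa>0$ such that $V_2(t,\phi)\le\kappa\sup_{s\in[-r,0]}V_1(t+s,\phi(s))$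 for all $t\in\mathbb{R}^+$, $\phi\in\mathcal{PC}$, and $\ln(\rho_1+[\rho_2+(1-\rho_1)\kappa]e^{\mu r})<\mu\delta$. Then the system is uniformly iISS over $\ell_{\inf}(\delta)$. -/

import Mathlib

open Set Filter Topology

/-- Euclidean space of dimension `n`. -/
abbrev Euc (n : ℕ) : Type := EuclideanSpace ℝ (Fin n)

/-- Functions on the delay window `[-r, 0]`. The space `PC` consists of those satisfying `IsPC`;
functionals on `PC` are given as functions of all of `Hist r n` whose values outside `PC`
are never used. -/
abbrev Hist (r : ℝ) (n : ℕ) : Type := Icc (-r) (0 : ℝ) → Euc n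

/-- The point `0` of the delay window `[-r, 0]`. -/
def windowEnd {r : ℝ} (hr : 0 < r) : Icc (-r) (0 : ℝ) := ⟨0, by linarith, le_rfl⟩

/-- `x` is piecewise right-continuous on the interval `J`: right-continuous with left limits, and
with finitely many discontinuities in every compact subinterval. Only the values of `x` on `J`
matter. -/
structure PCOn {E : Type*} [TopologicalSpace E] (x : ℝ → E) (J : Set ℝ) : Prop where
  right_cont : ∀ t ∈ J, ContinuousWithinAt x (J ∩ Ici t) t
  left_lim : ∀ t ∈ J, ∃ l, Tendsto x (𝓝[J ∩ Iio t] t) (𝓝 l)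
  finite_disc : ∀ a ∈ J, ∀ b ∈ J, {t ∈ Icc a b | ¬ ContinuousWithinAt x J t}.Finite

/-- Membership in `PC = PC([-r, 0], ℝⁿ)`. -/
def IsPC {r : ℝ} {n : ℕ} (φ : Hist r n) : Prop :=
  ∃ x : ℝ → Euc n, PCOn x (Icc (-r) 0) ∧ ∀ s : Icc (-r) (0 : ℝ), φ s = x s

/-- The norm `‖φ‖_r = sup_{s ∈ [-r, 0]} ‖φ s‖`. -/
noncomputable def normR {r : ℝ} {n : ℕ} (φ : Hist r n) : ℝ := ⨆ s, ‖φ s‖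

/-- The segment `x_t (s) = x (t + s)`. -/
def seg (r : ℝ) {n : ℕ} (x : ℝ → Euc n) (t : ℝ) : Hist r n := fun s => x (t + s)

/-- The segment `x_{t⁻}`, with `x_{t⁻}(s) = x (t + s)` for `s < 0` and `x_{t⁻}(0) = x (t⁻)`. -/
noncomputable def segLeft (r : ℝ) {n : ℕ} (x : ℝ → Euc n) (t : ℝ) : Hist r n :=
  fun s => if (s : ℝ) < 0 then x (t + s) else Function.leftLim x t

/-- Class `K`, for functions of a nonnegative argument. -/
structure ClassK (α : ℝ → ℝ) : Prop where
  cont : ContinuousOn α (Ici 0)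
  strictMono : StrictMonoOn α (Ici 0)
  zero : α 0 = 0

/-- Class `K∞`. -/
structure ClassKInf (α : ℝ → ℝ) : Prop extends ClassK α where
  unbounded : Tendsto α atTop atTop

/-- Class `KL`, for functions of two nonnegative arguments. -/
structure ClassKL (β : ℝ → ℝ → ℝ) : Prop where
  cont : ContinuousOn (fun p : ℝ × ℝ => β p.1 p.2) (Ici 0 ×ˢ Ici 0)
  classK : ∀ t, 0 ≤ t → ClassK (fun s => β s t)
  anti : ∀ s, 0 ≤ s → AntitoneOn (β s) (Ici 0)
  tendsto : ∀ s, 0 ≤ s → Tendsto (β s) atTop (𝓝 0)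

/-- Conditions on the right-hand side under which `x' = f(t, x_t, w)` has unique, continuable
solutions: for every initial time `t₀ ≥ 0` and every input `w`, the map `g(t, φ) = f(t, φ, w t)`
is composite-`PC` and locally Lipschitz in `φ`. (Continuity of `g` in `φ` and boundedness of `g`
on bounded sets follow from these two.) -/
structure RegularRHS {r : ℝ} {n m : ℕ} (f : ℝ → Hist r n → Euc m → Euc n) : Prop where
  composite_pc : ∀ t₀, 0 ≤ t₀ → ∀ w : ℝ → Euc m, PCOn w (Ici t₀) →
    ∀ x : ℝ → Euc n, PCOn x (Ici (t₀ - r)) → PCOn (fun t => f t (seg r x t) (w t)) (Ici t₀)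
  locally_lipschitz : ∀ t₀, 0 ≤ t₀ → ∀ w : ℝ → Euc m, PCOn w (Ici t₀) →
    ∀ b R : ℝ, ∃ L : ℝ, ∀ t ∈ Icc t₀ b, ∀ φ ψ : Hist r n, IsPC φ → IsPC ψ →
      (∀ s, ‖φ s‖ ≤ R) → (∀ s, ‖ψ s‖ ≤ R) →
      ‖f t φ (w t) - f t ψ (w t)‖ ≤ L * normR (φ - ψ)

/-- `x` solves the impulsive delay system on `J` (`J = [t₀, b)` or `J = [t₀, ∞)`) with initial
segment `φ` at `t₀`, input `w` and impulse times `τ 1 < τ 2 < …`. The derivative is the right-hand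
one, since the right-hand side may jump in `t`. -/
structure IsSolutionOn {r : ℝ} {n m : ℕ} (f : ℝ → Hist r n → Euc m → Euc n)
    (I : ℕ → ℝ → Hist r n → Euc m → Euc n) (τ : ℕ → ℝ) (w : ℝ → Euc m) (t₀ : ℝ) (φ : Hist r n)
    (J : Set ℝ) (x : ℝ → Euc n) : Prop where
  pc : PCOn x (Icc (t₀ - r) t₀ ∪ J)
  init : seg r x t₀ = φ
  cont : ∀ t ∈ J, t₀ < t → (∀ k, 1 ≤ k → t ≠ τ k) → ContinuousAt x t
  deriv : ∀ t ∈ J, HasDerivWithinAt x (f t (seg r x t) (w t)) (Ici t) t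
  jump : ∀ k, 1 ≤ k → τ k ∈ J → x (τ k) = Function.leftLim x (τ k) +
    I k (τ k) (segLeft r x (τ k)) (Function.leftLim w (τ k))

/-- `x` solves the continuous dynamics `x' = f(t, x_t, w)` on `[t₀, b)` with `x_{t₀} = φ`. Up to the
first impulse after `t₀`, these are the solutions of the impulsive system started at `t₀`. -/
structure IsFlowOn {r : ℝ} {n m : ℕ} (f : ℝ → Hist r n → Euc m → Euc n) (w : ℝ → Euc m)
    (t₀ : ℝ) (φ : Hist r n) (b : ℝ) (x : ℝ → Euc n) : Prop where
  init : seg r x t₀ = φ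
  cont : ContinuousOn x (Ico t₀ b)
  deriv : ∀ t ∈ Ico t₀ b, HasDerivWithinAt x (f t (seg r x t) (w t)) (Ici t) t

/-- The upper right-hand derivative of `V` at time `t` along `x`,
`limsup_{h → 0⁺} (V(t + h, x_{t+h}) - V(t, x_t)) / h`, as an extended real. -/
noncomputable def upperDini {r : ℝ} {n : ℕ} (V : ℝ → Hist r n → ℝ) (x : ℝ → Euc n) (t : ℝ) :
    EReal :=
  limsup (fun h : ℝ => (((V (t + h) (seg r x (t + h)) - V t (seg r x t)) / h : ℝ) : EReal))
    (𝓝[>] 0)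

/-- Class `ν₀`. -/
structure ClassNu {n : ℕ} (v : ℝ → Euc n → ℝ) : Prop where
  nonneg : ∀ t, 0 ≤ t → ∀ x, 0 ≤ v t x
  pc : ∀ x : ℝ → Euc n, PCOn x (Ici 0) → PCOn (fun t => v t (x t)) (Ici 0)
  cont : ∀ x : ℝ → Euc n, PCOn x (Ici 0) → ∀ t, 0 ≤ t → ContinuousWithinAt x (Ici 0) t →
    ContinuousWithinAt (fun t => v t (x t)) (Ici 0) t

/-- Class `ν₀*`. -/
def ClassNuStar {r : ℝ} {n : ℕ} (v : ℝ → Hist r n → ℝ) : Prop :=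
  ∀ x : ℝ → Euc n, PCOn x (Ici (-r)) → ContinuousOn (fun t => v t (seg r x t)) (Ici 0)

/-- The impulse time sequences `t₀ = τ 0 < τ 1 < τ 2 < … → ∞` with `τ k - τ (k - 1) ≥ δ` for
all `k ≥ 1`. -/
def dwellClass (δ t₀ : ℝ) : Set (ℕ → ℝ) :=
  {τ | τ 0 = t₀ ∧ StrictMono τ ∧ Tendsto τ atTop atTop ∧ ∀ k, δ ≤ τ (k + 1) - τ k}

/-- Uniform integral input-to-state stability over the class `ℓ` of impulse time sequences
(`ℓ t₀` being the sequences admitted for the initial time `t₀`): the solution, which is unique,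
exists globally and obeys the iISS estimate. -/
def UniformlyIISS {r : ℝ} {n m : ℕ} (f : ℝ → Hist r n → Euc m → Euc n)
    (I : ℕ → ℝ → Hist r n → Euc m → Euc n) (ℓ : ℝ → Set (ℕ → ℝ)) : Prop :=
  ∃ (β : ℝ → ℝ → ℝ) (α γ : ℝ → ℝ), ClassKL β ∧ ClassKInf α ∧ ClassKInf γ ∧
    ∀ t₀, 0 ≤ t₀ → ∀ τ ∈ ℓ t₀, ∀ φ : Hist r n, IsPC φ →
    ∀ w : ℝ → Euc m, PCOn w (Ici t₀) →
    ∃ x : ℝ → Euc n, IsSolutionOn f I τ w t₀ φ (Ici t₀) x ∧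
      (∀ (b : ℝ) (y : ℝ → Euc n), IsSolutionOn f I τ w t₀ φ (Ico t₀ b) y →
        EqOn y x (Ico t₀ b)) ∧
      ∀ t, t₀ ≤ t → α ‖x t‖ ≤ β (normR φ) (t - t₀) + (∫ s in t₀..t, γ ‖w s‖) +
        ∑ᶠ k ∈ {k : ℕ | t₀ < τ k ∧ τ k ≤ t}, γ ‖Function.leftLim w (τ k)‖

/-! Write `q` for the argument of the logarithm in (a) or (b). Along a flow, the Dini inequality
lets `e^{μt} V` grow only through the input: a factor `exp (∫ χ‖w‖)` and an additive term of size
`e^{μt} ∫ χ‖w‖` (`LyapunovPair.lyap_le`).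

At an impulse only `V₁` can jump: `t ↦ V₂(t, x_t)` is continuous, so `V₂` takes the same value
before and after. The supremum of `V₁` over the delay window is controlled by the bound on `e^{μt}
V` over the whole past, at the price of a factor `e^{μr}`. Hence an impulse multiplies the running
bound by at most `q` and adds a gain of the input (`LyapunovPair.lyap_jump_le`).

Put `ν = log q / δ`, so that `0 ≤ ν < μ` and `q = e^{νδ}`. Impulses being at least `δ` apart, each
factor `q` is paid for by the growth of `e^{νt}` over one dwell interval. So the effect of the
initial history on `V` decays at the rate `μ - ν`, and inputs are amplified by at most one factor
`q` (`LyapunovPair.exp_mul_lyap_le_envelope`). The remaining factor `exp (∫ χ‖w‖)` becomes a summand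
under `log (1 + ·)`, which gives the integral estimate with `α = log (1 + α₁)`.

Global existence uses the same Lyapunov estimate: the equation is truncated so as to be globally
Lipschitz, solved by Picard iteration, and the estimate shows that the truncation is never felt
(`LyapunovPair.exists_flow`). Flows and jumps are then concatenated. -/

namespace PCOn

/-! ### Calculus of piecewise right-continuous functions. -/

variable {E F : Type*}

theorem mono [TopologicalSpace E] {x : ℝ → E} {J J' : Set ℝ} (h : PCOn x J) (hJ : J' ⊆ J) :
    PCOn x J' where
  right_cont t ht := (h.right_cont t (hJ ht)).mono (inter_subset_inter_left _ hJ)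
  left_lim t ht := by
    obtain ⟨l, hl⟩ := h.left_lim t (hJ ht)
    exact ⟨l, hl.mono_left (nhdsWithin_mono _ (inter_subset_inter_left _ hJ))⟩
  finite_disc a ha b hb := (h.finite_disc a (hJ ha) b (hJ hb)).subset
    fun _ ht => ⟨ht.1, fun hc => ht.2 (hc.mono hJ)⟩

theorem congr [TopologicalSpace E] {x y : ℝ → E} {J : Set ℝ} [J.OrdConnected] (h : PCOn x J)
    (hy : EqOn y x J) : PCOn y J where
  right_cont t ht := (h.right_cont t ht).congr (fun s hs => hy hs.1) (hy ht)
  left_lim t ht := by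
    obtain ⟨l, hl⟩ := h.left_lim t ht
    refine ⟨l, hl.congr' ?_⟩
    filter_upwards [self_mem_nhdsWithin] with s hs using (hy hs.1).symm
  finite_disc a ha b hb := (h.finite_disc a ha b hb).subset fun t ht =>
    ⟨ht.1, fun hc => ht.2 (hc.congr (fun s hs => hy hs) (hy (J.Icc_subset ha hb ht.1)))⟩

theorem of_continuousOn [TopologicalSpace E] {x : ℝ → E} {J : Set ℝ} [J.OrdConnected]
    (h : ContinuousOn x J) : PCOn x J where
  right_cont t ht := (h t ht).mono inter_subset_left
  left_lim t ht := ⟨x t, (h t ht).mono_left (nhdsWithin_mono _ inter_subset_left)⟩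
  finite_disc a ha b hb := by
    convert Set.finite_empty
    ext t
    simp only [mem_ofPred_eq, mem_empty_iff_false, iff_false, not_and, not_not]
    exact fun ht => h t (J.Icc_subset ha hb ht)

theorem continuous_comp [TopologicalSpace E] [TopologicalSpace F] {x : ℝ → E} {J : Set ℝ}
    {g : E → F} (hg : Continuous g) (h : PCOn x J) : PCOn (fun t => g (x t)) J where
  right_cont t ht := hg.continuousAt.comp_continuousWithinAt (h.right_cont t ht)
  left_lim t ht := by
    obtain ⟨l, hl⟩ := h.left_lim t ht
    exact ⟨g l, (hg.tendsto l).comp hl⟩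
  finite_disc a ha b hb := (h.finite_disc a ha b hb).subset fun t ht =>
    ⟨ht.1, fun hc => ht.2 (hg.continuousAt.comp_continuousWithinAt hc)⟩

theorem shift [TopologicalSpace E] {x : ℝ → E} {J : Set ℝ} (h : PCOn x J) (c : ℝ) :
    PCOn (fun t => x (t + c)) {t | t + c ∈ J} where
  right_cont t ht := ContinuousWithinAt.comp (g := x) (t := J ∩ Ici (t + c)) (h.right_cont _ ht)
    (by fun_prop) (fun s hs => ⟨hs.1, by simpa using hs.2⟩)
  left_lim t ht := by
    obtain ⟨l, hl⟩ := h.left_lim _ ht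
    refine ⟨l, hl.comp (tendsto_nhdsWithin_iff.2 ⟨?_, ?_⟩)⟩
    · exact (continuous_add_const c).continuousAt.mono_left nhdsWithin_le_nhds
    · filter_upwards [self_mem_nhdsWithin] with s hs using ⟨hs.1, by simpa using hs.2⟩
  finite_disc a ha b hb := by
    refine ((h.finite_disc _ ha _ hb).preimage ((add_left_injective c).injOn)).subset fun t ht => ?_
    refine ⟨⟨by simpa using ht.1.1, by simpa using ht.1.2⟩, fun hc => ht.2 ?_⟩
    exact ContinuousWithinAt.comp (g := x) (t := J) hc (by fun_prop) (fun s hs => hs)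

/-- The left piece is `PC` up to and including `T`, which supplies the left limit there; gluing adds
at most the discontinuity `T`. -/
theorem glue [TopologicalSpace E] {u v : ℝ → E} {J : Set ℝ} [J.OrdConnected] {T : ℝ} (hT : T ∈ J)
    (hu : PCOn u (J ∩ Iic T)) (hv : PCOn v (J ∩ Ici T)) :
    PCOn (fun t => if t < T then u t else v t) J := by
  have hlt : ∀ t < T, (fun t => if t < T then u t else v t) =ᶠ[𝓝 t] u := fun t ht => by
    filter_upwards [Iio_mem_nhds ht] with s hs using if_pos hs
  have hgt : ∀ t, T < t → (fun t => if t < T then u t else v t) =ᶠ[𝓝 t] v := fun t ht => by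
    filter_upwards [Ioi_mem_nhds ht] with s hs using if_neg (not_lt.2 (le_of_lt hs))
  refine ⟨fun t ht => ?_, fun t ht => ?_, fun a ha b hb => ?_⟩
  · rcases lt_or_ge t T with h | h
    · refine ContinuousWithinAt.congr_of_eventuallyEq ?_ ((hlt t h).filter_mono nhdsWithin_le_nhds)
        (hlt t h).eq_of_nhds
      refine (hu.right_cont t ⟨ht, h.le⟩).mono_of_mem_nhdsWithin ?_
      filter_upwards [self_mem_nhdsWithin, mem_nhdsWithin_of_mem_nhds (Iio_mem_nhds h)] with s hs hs'
        using ⟨⟨hs.1, mem_Iic.2 (le_of_lt hs')⟩, hs.2⟩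
    · have hc : ContinuousWithinAt (fun t => if t < T then u t else v t) (J ∩ Ici T ∩ Ici t) t :=
        (hv.right_cont t ⟨ht, h⟩).congr (fun s hs => if_neg (not_lt.2 (mem_Ici.1 hs.1.2)))
          (if_neg (not_lt.2 h))
      refine hc.mono fun s hs => ?_
      exact ⟨⟨hs.1, mem_Ici.2 (h.trans (mem_Ici.1 hs.2))⟩, hs.2⟩
  · rcases le_or_gt t T with h | h
    · obtain ⟨l, hl⟩ := hu.left_lim t ⟨ht, h⟩
      refine ⟨l, (hl.mono_left (nhdsWithin_mono _ fun s hs =>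
        ⟨⟨hs.1, (lt_of_lt_of_le hs.2 h).le⟩, hs.2⟩)).congr' ?_⟩
      filter_upwards [self_mem_nhdsWithin] with s hs using (if_pos (lt_of_lt_of_le hs.2 h)).symm
    · obtain ⟨l, hl⟩ := hv.left_lim t ⟨ht, h.le⟩
      refine ⟨l, Tendsto.congr' ((hgt t h).filter_mono nhdsWithin_le_nhds).symm
        (hl.mono_left (nhdsWithin_le_iff.2 ?_))⟩
      filter_upwards [self_mem_nhdsWithin, mem_nhdsWithin_of_mem_nhds (Ioi_mem_nhds h)] with s hs hs'
        using ⟨⟨hs.1, mem_Ici.2 (le_of_lt hs')⟩, hs.2⟩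
  · have h1 : {t ∈ Icc a T | t < T ∧ t ∈ J ∧ ¬ ContinuousWithinAt u (J ∩ Iic T) t}.Finite := by
      rcases le_or_gt a T with h | h
      · exact (hu.finite_disc a ⟨ha, h⟩ T ⟨hT, self_mem_Iic⟩).subset fun t ht => ⟨ht.1, ht.2.2.2⟩
      · simp [Icc_eq_empty (not_le.2 h)]
    have h2 : {t ∈ Icc T b | T < t ∧ t ∈ J ∧ ¬ ContinuousWithinAt v (J ∩ Ici T) t}.Finite := by
      rcases le_or_gt T b with h | h
      · exact (hv.finite_disc T ⟨hT, self_mem_Ici⟩ b ⟨hb, h⟩).subset fun t ht => ⟨ht.1, ht.2.2.2⟩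
      · simp [Icc_eq_empty (not_le.2 h)]
    refine ((h1.union h2).union (finite_singleton T)).subset fun t ht => ?_
    have htJ : t ∈ J := J.Icc_subset ha hb ht.1
    rcases lt_trichotomy t T with h | h | h
    · refine Or.inl (Or.inl ⟨⟨ht.1.1, h.le⟩, h, htJ, fun hc => ht.2 ?_⟩)
      refine ContinuousWithinAt.congr_of_eventuallyEq ?_ ((hlt t h).filter_mono nhdsWithin_le_nhds)
        (hlt t h).eq_of_nhds
      refine hc.mono_of_mem_nhdsWithin ?_
      filter_upwards [self_mem_nhdsWithin, mem_nhdsWithin_of_mem_nhds (Iio_mem_nhds h)] with s hs hs'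
        using ⟨hs, mem_Iic.2 (le_of_lt hs')⟩
    · exact Or.inr h
    · refine Or.inl (Or.inr ⟨⟨h.le, ht.1.2⟩, h, htJ, fun hc => ht.2 ?_⟩)
      refine ContinuousWithinAt.congr_of_eventuallyEq ?_ ((hgt t h).filter_mono nhdsWithin_le_nhds)
        (hgt t h).eq_of_nhds
      refine hc.mono_of_mem_nhdsWithin ?_
      filter_upwards [self_mem_nhdsWithin, mem_nhdsWithin_of_mem_nhds (Ioi_mem_nhds h)] with s hs hs'
        using ⟨hs, mem_Ici.2 (le_of_lt hs')⟩

/-- One-sided limits bound the function near each point, and compactness does the rest. -/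
theorem exists_norm_le [NormedAddCommGroup E] {x : ℝ → E} {a b : ℝ} (h : PCOn x (Icc a b)) :
    ∃ C, ∀ t ∈ Icc a b, ‖x t‖ ≤ C := by
  refine isCompact_Icc.induction_on (p := fun S => ∃ C, ∀ t ∈ S, ‖x t‖ ≤ C) ⟨0, by simp⟩
    (fun S S' hS ⟨C, hC⟩ => ⟨C, fun t ht => hC t (hS ht)⟩) (fun S S' ⟨C, hC⟩ ⟨C', hC'⟩ =>
      ⟨max C C', ?_⟩) fun t ht => ?_
  · rintro t (ht | ht)
    · exact (hC t ht).trans (le_max_left _ _)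
    · exact (hC' t ht).trans (le_max_right _ _)
  · obtain ⟨l, hl⟩ := h.left_lim t ht
    have h1 : ∀ᶠ s in 𝓝[Icc a b ∩ Ici t] t, ‖x s‖ < ‖x t‖ + 1 :=
      (h.right_cont t ht).norm.eventually_lt continuousWithinAt_const (by simp)
    have h2 : ∀ᶠ s in 𝓝[Icc a b ∩ Iio t] t, ‖x s‖ < ‖l‖ + 1 :=
      hl.norm.eventually_lt tendsto_const_nhds (by simp)
    have h3 : ∀ᶠ s in 𝓝[Icc a b] t, ‖x s‖ ≤ max (‖x t‖ + 1) (‖l‖ + 1) := by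
      have : Icc a b = (Icc a b ∩ Ici t) ∪ (Icc a b ∩ Iio t) := by
        rw [← inter_union_distrib_left, Ici_union_Iio, inter_univ]
      rw [this, nhdsWithin_union, eventually_sup]
      exact ⟨h1.mono fun s hs => hs.le.trans (le_max_left _ _),
        h2.mono fun s hs => hs.le.trans (le_max_right _ _)⟩
    exact ⟨_, h3, _, fun s hs => hs⟩

open MeasureTheory in
theorem intervalIntegrable [NormedAddCommGroup E] {x : ℝ → E} {a b : ℝ}
    (h : PCOn x (Icc a b)) (hab : a ≤ b) : IntervalIntegrable x volume a b := by
  rw [intervalIntegrable_iff_integrableOn_Icc_of_le hab]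
  obtain ⟨C, hC⟩ := h.exists_norm_le
  have hfin := h.finite_disc a (left_mem_Icc.2 hab) b (right_mem_Icc.2 hab)
  set N := {t ∈ Icc a b | ¬ ContinuousWithinAt x (Icc a b) t} with hN
  have hcont : ContinuousOn x (Icc a b \ N) := fun t ht =>
    (not_not.1 fun hc => ht.2 ⟨ht.1, hc⟩ : ContinuousWithinAt x (Icc a b) t).mono sdiff_subset
  have hI : IntegrableOn x (Icc a b \ N) := by
    refine ⟨hcont.aestronglyMeasurable (measurableSet_Icc.diff hfin.measurableSet), ?_⟩
    refine HasFiniteIntegral.restrict_of_bounded C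
      ((measure_mono sdiff_subset).trans_lt measure_Icc_lt_top) ?_
    exact (ae_restrict_iff' (measurableSet_Icc.diff hfin.measurableSet)).2
      (Eventually.of_forall fun t ht => hC t ht.1)
  exact hI.congr_set_ae (sdiff_null_ae_eq_self (hfin.measure_zero volume)).symm

theorem intervalIntegrable_Ici [NormedAddCommGroup E] {x : ℝ → E} {T a b : ℝ}
    (h : PCOn x (Ici T)) (ha : T ≤ a) (hb : T ≤ b) :
    IntervalIntegrable x MeasureTheory.volume a b := by
  rcases le_total a b with hab | hab
  · exact (h.mono (Icc_subset_Ici_self.trans (Ici_subset_Ici.2 ha))).intervalIntegrable hab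
  · exact ((h.mono (Icc_subset_Ici_self.trans (Ici_subset_Ici.2 hb))).intervalIntegrable hab).symm

theorem hasDerivWithinAt_integral [NormedAddCommGroup E] [NormedSpace ℝ E] [CompleteSpace E]
    {x : ℝ → E} {T a t : ℝ} (h : PCOn x (Ici T)) (ha : T ≤ a) (ht : T ≤ t) :
    HasDerivWithinAt (fun u => ∫ s in a..u, x s) (x t) (Ici t) t := by
  have hc : ContinuousWithinAt x (Ici t) t :=
    (h.right_cont t ht).mono fun s hs => ⟨le_trans ht hs, hs⟩
  refine intervalIntegral.integral_hasDerivWithinAt_right (h.intervalIntegrable_Ici ha ht) ?_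
    (hc.mono Ioi_subset_Ici_self)
  refine ⟨Ioc t (t + 1), Ioc_mem_nhdsGT (by linarith), ?_⟩
  exact (h.intervalIntegrable_Ici ht (by linarith : T ≤ t + 1)).1.aestronglyMeasurable

theorem continuousOn_integral [NormedAddCommGroup E] [NormedSpace ℝ E]
    {x : ℝ → E} {T : ℝ} (h : PCOn x (Ici T)) :
    ContinuousOn (fun u => ∫ s in T..u, x s) (Ici T) := by
  intro t ht
  have h1 : ContinuousOn (fun u => ∫ s in T..u, x s) (Icc T (t + 1)) := by
    have := intervalIntegral.continuousOn_primitive_interval' (b₁ := T) (b₂ := t + 1) (a := T)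
      (h.intervalIntegrable_Ici le_rfl (by have : T ≤ t := ht; linarith)) left_mem_uIcc
    rwa [uIcc_of_le (by have : T ≤ t := ht; linarith)] at this
  refine (h1 t ⟨ht, by linarith⟩).mono_of_mem_nhdsWithin ?_
  filter_upwards [self_mem_nhdsWithin, mem_nhdsWithin_of_mem_nhds (Iio_mem_nhds (lt_add_one t))]
    with s hs hs' using ⟨hs, le_of_lt hs'⟩

theorem tendsto_leftLim [TopologicalSpace E] [T2Space E] {x : ℝ → E} {J : Set ℝ} {c t : ℝ}
    (h : PCOn x J) (ht : t ∈ J) (hc : c < t) (hJ : Ioo c t ⊆ J) :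
    Tendsto x (𝓝[<] t) (𝓝 (Function.leftLim x t)) := by
  obtain ⟨l, hl⟩ := h.left_lim t ht
  have hl' : Tendsto x (𝓝[<] t) (𝓝 l) := by
    refine hl.mono_left (nhdsWithin_le_iff.2 ?_)
    filter_upwards [Ioo_mem_nhdsLT hc] with s hs using ⟨hJ hs, hs.2⟩
  rwa [leftLim_eq_of_tendsto hl']

end PCOn

/-! ### Comparison functions and history segments. -/

theorem ClassK.nonneg {α : ℝ → ℝ} (h : ClassK α) {s : ℝ} (hs : 0 ≤ s) : 0 ≤ α s := by
  rw [← h.zero]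
  exact h.strictMono.monotoneOn (mem_Ici.2 le_rfl) hs hs

theorem ClassK.mono {α : ℝ → ℝ} (h : ClassK α) {s t : ℝ} (hs : 0 ≤ s) (hst : s ≤ t) : α s ≤ α t :=
  h.strictMono.monotoneOn hs (hs.trans hst) hst

theorem ClassK.continuous_norm {E : Type*} [NormedAddCommGroup E] {α : ℝ → ℝ} (h : ClassK α) :
    Continuous fun y : E => α ‖y‖ :=
  h.cont.comp_continuous _root_.continuous_norm fun y => mem_Ici.2 (norm_nonneg y)

theorem isPC_seg {r : ℝ} {n : ℕ} {x : ℝ → Euc n} {t : ℝ} (h : PCOn x (Icc (t - r) t)) :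
    IsPC (seg r x t) := by
  refine ⟨fun s => x (s + t), (h.shift t).mono fun s hs => ⟨?_, ?_⟩, fun s => ?_⟩
  · linarith [hs.1]
  · linarith [hs.2]
  · simp [seg, add_comm]

theorem IsPC.exists_norm_le {r : ℝ} {n : ℕ} {φ : Hist r n} (h : IsPC φ) :
    ∃ C, ∀ s, ‖φ s‖ ≤ C := by
  obtain ⟨x, hx, hφ⟩ := h
  obtain ⟨C, hC⟩ := hx.exists_norm_le
  exact ⟨C, fun s => hφ s ▸ hC s s.2⟩

theorem IsPC.norm_le_normR {r : ℝ} {n : ℕ} {φ : Hist r n} (h : IsPC φ) (s : Icc (-r) (0 : ℝ)) :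
    ‖φ s‖ ≤ normR φ := by
  obtain ⟨C, hC⟩ := h.exists_norm_le
  exact le_ciSup (f := fun s => ‖φ s‖) ⟨C, by rintro _ ⟨s, rfl⟩; exact hC s⟩ s

theorem IsPC.continuous_comp {r : ℝ} {n : ℕ} {φ : Hist r n} (h : IsPC φ) {g : Euc n → Euc n}
    (hg : Continuous g) : IsPC fun s => g (φ s) := by
  obtain ⟨x, hx, hφ⟩ := h
  exact ⟨fun t => g (x t), hx.continuous_comp hg, fun s => congrArg g (hφ s)⟩

theorem IsPC.exists_extension {r : ℝ} {n : ℕ} {φ : Hist r n} (h : IsPC φ) (T : ℝ) :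
    ∃ u : ℝ → Euc n, PCOn u (Icc (T - r) T) ∧ seg r u T = φ := by
  obtain ⟨x, hx, hφ⟩ := h
  refine ⟨fun t => x (t + -T), (hx.shift (-T)).mono fun t ht => ⟨?_, ?_⟩, ?_⟩
  · linarith [ht.1]
  · linarith [ht.2]
  · funext s
    simp [seg, hφ]

/-- Constant extension on both sides. It makes the continuity of `V₂`, postulated for functions on a
half-line, available on compact intervals. -/
theorem PCOn.exists_extension {E : Type*} [TopologicalSpace E] {x : ℝ → E} {a₀ a c : ℝ}
    (h : PCOn x (Icc a c)) (h0 : a₀ ≤ a) (hac : a ≤ c) :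
    ∃ z : ℝ → E, PCOn z (Ici a₀) ∧ EqOn z x (Icc a c) := by
  have h1 : PCOn (fun t => if t < c then x t else x c) (Ici a) :=
    PCOn.glue (mem_Ici.2 hac) (h.mono fun t ht => ⟨ht.1, ht.2⟩)
      (PCOn.of_continuousOn (J := Ici c) continuousOn_const |>.mono inter_subset_right)
  refine ⟨fun t => if t < a then x a else if t < c then x t else x c,
    PCOn.glue (v := fun t => if t < c then x t else x c) (mem_Ici.2 h0)
    (PCOn.of_continuousOn (J := Iic a) continuousOn_const |>.mono inter_subset_right)
    (h1.mono inter_subset_right), fun t ht => ?_⟩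
  have h2 : ¬ t < a := not_lt.2 ht.1
  rcases ht.2.lt_or_eq with h3 | h3
  · simp [h2, h3]
  · subst h3; simp [h2]

theorem eq_of_seg_eq {r : ℝ} {n : ℕ} {x y : ℝ → Euc n} {T : ℝ} (h : seg r x T = seg r y T) :
    EqOn x y (Icc (T - r) T) := by
  intro t ht
  have := congrFun h ⟨t - T, by linarith [ht.1], by linarith [ht.2]⟩
  simpa [seg] using this

theorem seg_congr {r : ℝ} {n : ℕ} {x y : ℝ → Euc n} {T : ℝ} (h : EqOn x y (Icc (T - r) T)) :
    seg r x T = seg r y T := by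
  funext s
  exact h ⟨by linarith [s.2.1], by linarith [s.2.2]⟩

theorem IsFlowOn.pcOn {r : ℝ} (hr : 0 < r) {n m : ℕ} {f : ℝ → Hist r n → Euc m → Euc n}
    {w : ℝ → Euc m} {T b : ℝ} {φ : Hist r n} {x : ℝ → Euc n} (h : IsFlowOn f w T φ b x)
    (hφ : IsPC φ) (hb : T < b) : PCOn x (Ico (T - r) b) := by
  obtain ⟨u, hu, hφu⟩ := hφ.exists_extension T
  have hg : PCOn (fun t => if t < T then u t else x t) (Ico (T - r) b) :=
    PCOn.glue ⟨by linarith, hb⟩ (hu.mono fun t ht => ⟨ht.1.1, ht.2⟩)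
      ((PCOn.of_continuousOn h.cont).mono fun t ht => ⟨ht.2, ht.1.2⟩)
  refine hg.congr fun t ht => ?_
  rcases lt_or_ge t T with h' | h'
  · simp only [h', if_true]
    exact eq_of_seg_eq (h.init.trans hφu.symm) ⟨ht.1, h'.le⟩
  · simp [not_lt.2 h']

/-! ### Growth of the Lyapunov functional along flows. -/

/-- The Lyapunov functional along `x`. -/
def lyap {r : ℝ} {n : ℕ} (V₁ : ℝ → Euc n → ℝ) (V₂ : ℝ → Hist r n → ℝ) (x : ℝ → Euc n) (t : ℝ) : ℝ :=
  V₁ t (x t) + V₂ t (seg r x t)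

/-- A Lyapunov functional `V₁ + V₂` with bounds on its values and on its growth along flows. -/
structure LyapunovPair {r : ℝ} (hr : 0 < r) {n m : ℕ} (f : ℝ → Hist r n → Euc m → Euc n)
    (V₁ : ℝ → Euc n → ℝ) (V₂ : ℝ → Hist r n → ℝ) (α₁ α₂ α₃ χ : ℝ → ℝ) (μ : ℝ) : Prop where
  nu : ClassNu V₁
  nuStar : ClassNuStar V₂
  kinf₁ : ClassKInf α₁
  kinf₂ : ClassKInf α₂
  kinf₃ : ClassKInf α₃
  kinf_gain : ClassKInf χ
  rate_pos : 0 < μ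
  bounds₁ : ∀ t, -r ≤ t → ∀ x, α₁ ‖x‖ ≤ V₁ t x ∧ V₁ t x ≤ α₂ ‖x‖
  bounds₂ : ∀ t, 0 ≤ t → ∀ φ : Hist r n, IsPC φ → 0 ≤ V₂ t φ ∧ V₂ t φ ≤ α₃ (normR φ)
  dini : ∀ t, 0 ≤ t → ∀ φ : Hist r n, IsPC φ → ∀ w : ℝ → Euc m, PCOn w (Ici t) →
      ∀ b, t < b → ∀ x : ℝ → Euc n, IsFlowOn f w t φ b x →
      upperDini (fun u ψ => V₁ u (ψ (windowEnd hr)) + V₂ u ψ) x t ≤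
        (((χ ‖w t‖ - μ) * (V₁ t (φ (windowEnd hr)) + V₂ t φ) + χ ‖w t‖ : ℝ) : EReal)

namespace LyapunovPair

variable {r : ℝ} {hr : 0 < r} {n m : ℕ} {f : ℝ → Hist r n → Euc m → Euc n}
    {V₁ : ℝ → Euc n → ℝ} {V₂ : ℝ → Hist r n → ℝ} {α₁ α₂ α₃ χ : ℝ → ℝ} {μ : ℝ}

theorem continuousOn_nuStar (h : LyapunovPair hr f V₁ V₂ α₁ α₂ α₃ χ μ) {x : ℝ → Euc n} {T c : ℝ}
    (hT : 0 ≤ T) (hTc : T ≤ c) (hx : PCOn x (Icc (T - r) c)) :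
    ContinuousOn (fun t => V₂ t (seg r x t)) (Icc T c) := by
  obtain ⟨z, hz, hzx⟩ := hx.exists_extension (a₀ := -r) (by linarith) (by linarith)
  refine ((h.nuStar z hz).mono fun t ht => mem_Ici.2 (hT.trans ht.1)).congr fun t ht => ?_
  rw [seg_congr (y := z)]
  exact fun s hs => (hzx ⟨by linarith [hs.1, ht.1], hs.2.trans ht.2⟩).symm

theorem continuousOn_lyap (h : LyapunovPair hr f V₁ V₂ α₁ α₂ α₃ χ μ) {x : ℝ → Euc n} {T c : ℝ}
    (hT : 0 ≤ T) (hTc : T ≤ c) (hx : PCOn x (Icc (T - r) c)) (hc : ContinuousOn x (Icc T c)) :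
    ContinuousOn (lyap V₁ V₂ x) (Icc T c) := by
  refine ContinuousOn.add ?_ (h.continuousOn_nuStar hT hTc hx)
  · have hy : Continuous (IccExtend hTc (fun t : Icc T c => x t)) :=
      (continuousOn_iff_continuous_domRestrict.1 hc).Icc_extend'
    have hV : ContinuousOn (fun t => V₁ t (IccExtend hTc (fun t : Icc T c => x t) t)) (Ici 0) :=
      fun t ht => h.nu.cont _ (PCOn.of_continuousOn hy.continuousOn) t ht hy.continuousWithinAt
    refine (hV.mono fun t ht => mem_Ici.2 (hT.trans ht.1)).congr fun t ht => ?_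
    simp only
    rw [IccExtend_of_mem _ _ ht]

theorem frequently_slope_lt (h : LyapunovPair hr f V₁ V₂ α₁ α₂ α₃ χ μ) {w : ℝ → Euc m} {T b : ℝ}
    {φ : Hist r n} {x : ℝ → Euc n} (hT : 0 ≤ T) (hφ : IsPC φ) (hw : PCOn w (Ici T))
    (hx : IsFlowOn f w T φ b x) {t : ℝ} (ht : t ∈ Ico T b) {c : ℝ}
    (hc : (χ ‖w t‖ - μ) * lyap V₁ V₂ x t + χ ‖w t‖ < c) :
    ∃ᶠ z in 𝓝[>] t, slope (lyap V₁ V₂ x) t z < c := by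
  have hpc : IsPC (seg r x t) := isPC_seg <| (hx.pcOn hr hφ (ht.1.trans_lt ht.2)).mono
    fun s hs => ⟨by linarith [hs.1, ht.1], hs.2.trans_lt ht.2⟩
  have hflow : IsFlowOn f w t (seg r x t) b x := ⟨rfl, hx.cont.mono (Ico_subset_Ico_left ht.1),
    fun s hs => hx.deriv s ⟨ht.1.trans hs.1, hs.2⟩⟩
  have hd := h.dini t (hT.trans ht.1) _ hpc w (hw.mono (Ici_subset_Ici.2 ht.1)) b ht.2 x hflow
  have hend : ∀ s, seg r x s (windowEnd hr) = x s := fun s => by simp [seg, windowEnd]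
  simp only [upperDini, hend] at hd
  have hev := eventually_lt_of_limsup_lt (hd.trans_lt (EReal.coe_lt_coe_iff.2 hc))
  refine Eventually.frequently ?_
  have hmap : Tendsto (fun z => z - t) (𝓝[>] t) (𝓝[>] 0) := by
    refine tendsto_nhdsWithin_iff.2 ⟨?_, ?_⟩
    · have : Tendsto (fun z => z - t) (𝓝 t) (𝓝 (t - t)) := (continuous_sub_right t).tendsto t
      rw [sub_self] at this
      exact this.mono_left nhdsWithin_le_nhds
    · filter_upwards [self_mem_nhdsWithin] with z hz using mem_Ioi.2 (sub_pos.2 hz)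
  filter_upwards [hmap.eventually hev] with z hz
  rw [EReal.coe_lt_coe_iff, add_sub_cancel] at hz
  rwa [slope_def_field]

theorem gain_nonneg (h : LyapunovPair hr f V₁ V₂ α₁ α₂ α₃ χ μ) (y : Euc m) : 0 ≤ χ ‖y‖ :=
  h.kinf_gain.toClassK.nonneg (norm_nonneg y)

theorem pcOn_gain (h : LyapunovPair hr f V₁ V₂ α₁ α₂ α₃ χ μ) {w : ℝ → Euc m} {J : Set ℝ}
    (hw : PCOn w J) : PCOn (fun s => χ ‖w s‖) J :=
  PCOn.continuous_comp (g := fun y : Euc m => χ ‖y‖) h.kinf_gain.toClassK.continuous_norm hw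

/-- Growth of the Lyapunov functional along a flow, up to an arbitrarily small slope `ε`. -/
theorem lyap_le_add (h : LyapunovPair hr f V₁ V₂ α₁ α₂ α₃ χ μ) {w : ℝ → Euc m} {T b : ℝ}
    {φ : Hist r n} {x : ℝ → Euc n} (hT : 0 ≤ T) (hφ : IsPC φ) (hw : PCOn w (Ici T))
    (hx : IsFlowOn f w T φ b x) {t : ℝ} (ht : t ∈ Ico T b) {ε : ℝ} (hε : 0 < ε) :
    lyap V₁ V₂ x t ≤ Real.exp (-μ * (t - T)) * Real.exp (∫ s in T..t, χ ‖w s‖) *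
      (lyap V₁ V₂ x T + Real.exp (μ * (t - T)) * (∫ s in T..t, χ ‖w s‖) + ε * (t - T)) := by
  have hχw := h.pcOn_gain hw
  set X : ℝ → ℝ := fun t => ∫ s in T..t, χ ‖w s‖ with hX
  have hX0 : X T = 0 := by simp [hX]
  have hXnn : ∀ t, T ≤ t → 0 ≤ X t := fun t ht =>
    intervalIntegral.integral_nonneg ht fun s _ => h.gain_nonneg _
  have hpc := (hx.pcOn hr hφ (ht.1.trans_lt ht.2)).mono
    (show Icc (T - r) t ⊆ Ico (T - r) b from fun s hs => ⟨hs.1, hs.2.trans_lt ht.2⟩)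
  have hcont := h.continuousOn_lyap hT ht.1 hpc
    (hx.cont.mono fun s hs => ⟨hs.1, hs.2.trans_lt ht.2⟩)
  have hXc : ContinuousOn X (Icc T t) := hχw.continuousOn_integral.mono Icc_subset_Ici_self
  have hXd : ∀ s ∈ Ico T t, HasDerivWithinAt X (χ ‖w s‖) (Ici s) s := fun s hs =>
    hχw.hasDerivWithinAt_integral le_rfl hs.1
  have hlin : ∀ c s : ℝ, ∀ S : Set ℝ, HasDerivWithinAt (fun u => c * (u - T)) c S s := by
    intro c s S
    simpa using (((hasDerivAt_id s).sub_const T).const_mul c).hasDerivWithinAt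
  have hBd : ∀ s ∈ Ico T t, HasDerivWithinAt
      (fun t => Real.exp (-μ * (t - T)) * Real.exp (X t) *
        (lyap V₁ V₂ x T + Real.exp (μ * (t - T)) * X t + ε * (t - T))) _ (Ici s) s := fun s hs =>
    ((hlin (-μ) s _).exp.mul (hXd s hs).exp).mul
      ((((hlin μ s _).exp.mul (hXd s hs)).const_add _).add (hlin ε s _))
  -- The comparison principle asks for a strict inequality of slopes where the two functions meet;
  -- the term `ε * (t - T)` provides it. With `c = χ‖w‖` and `B` the right-hand side, `B' = (c - μ)
  -- B + e^X (μ X + c)` plus a positive multiple of `ε`, which exceeds `(c - μ) B + c`.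
  refine image_le_of_liminf_slope_right_lt_deriv_boundary' hcont
    (f' := fun s => (χ ‖w s‖ - μ) * lyap V₁ V₂ x s + χ ‖w s‖)
    (fun s hs c hc => h.frequently_slope_lt hT hφ hw hx ⟨hs.1, hs.2.trans ht.2⟩ hc)
    (by simp [hX0]) (by fun_prop) hBd (fun s hs heq => ?_) (right_mem_Icc.2 ht.1)
  simp only [heq, Pi.mul_apply]
  have hc := h.gain_nonneg (w s)
  have hXs := hXnn s hs.1
  set c := χ ‖w s‖
  set E := Real.exp (X s)
  set G := lyap V₁ V₂ x T + Real.exp (μ * (s - T)) * X s + ε * (s - T)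
  have hE1 : 1 ≤ E := Real.one_le_exp hXs
  have hee : Real.exp (-μ * (s - T)) * Real.exp (μ * (s - T)) = 1 := by
    rw [← Real.exp_add]; simp
  set e := Real.exp (-μ * (s - T)) with he
  set e' := Real.exp (μ * (s - T))
  have hepos : 0 < e := Real.exp_pos _
  have h1 : 0 < e * E * ε := by positivity
  have h2 : 0 ≤ E * (μ * X s) := by have := h.rate_pos; positivity
  have h3 : 0 ≤ (E - 1) * c := mul_nonneg (by linarith) hc
  have h4 : e * E * (e' * μ * X s + e' * c) = E * (μ * X s + c) := by
    calc _ = (e * e') * (E * (μ * X s + c)) := by ring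
      _ = _ := by rw [hee, one_mul]
  linarith

theorem lyap_le (h : LyapunovPair hr f V₁ V₂ α₁ α₂ α₃ χ μ) {w : ℝ → Euc m} {T b : ℝ}
    {φ : Hist r n} {x : ℝ → Euc n} (hT : 0 ≤ T) (hφ : IsPC φ) (hw : PCOn w (Ici T))
    (hx : IsFlowOn f w T φ b x) {t : ℝ} (ht : t ∈ Ico T b) :
    lyap V₁ V₂ x t ≤ Real.exp (-μ * (t - T)) * Real.exp (∫ s in T..t, χ ‖w s‖) *
      (lyap V₁ V₂ x T + Real.exp (μ * (t - T)) * (∫ s in T..t, χ ‖w s‖)) := by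
  have hlim : Tendsto (fun ε : ℝ => Real.exp (-μ * (t - T)) * Real.exp (∫ s in T..t, χ ‖w s‖) *
      (lyap V₁ V₂ x T + Real.exp (μ * (t - T)) * (∫ s in T..t, χ ‖w s‖) + ε * (t - T))) (𝓝[>] 0)
      (𝓝 (Real.exp (-μ * (t - T)) * Real.exp (∫ s in T..t, χ ‖w s‖) *
      (lyap V₁ V₂ x T + Real.exp (μ * (t - T)) * (∫ s in T..t, χ ‖w s‖) + 0 * (t - T)))) :=
    (Continuous.tendsto (by fun_prop) 0).mono_left nhdsWithin_le_nhds
  rw [zero_mul, add_zero] at hlim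
  refine ge_of_tendsto hlim ?_
  filter_upwards [self_mem_nhdsWithin] with ε hε using h.lyap_le_add hT hφ hw hx ht hε

end LyapunovPair

/-! ### Existence and uniqueness for the delay equation. -/

theorem exists_clamp (n : ℕ) {R : ℝ} (hR : 0 ≤ R) : ∃ P : Euc n → Euc n,
    (∀ x y, ‖P x - P y‖ ≤ ‖x - y‖) ∧ (∃ C, ∀ x, ‖P x‖ ≤ C) ∧ ∀ x, ‖x‖ ≤ R → P x = x := by
  refine ⟨fun y => WithLp.toLp 2 fun i => max (-R) (min R (y i)), fun x y => ?_,
    ⟨√(∑ _i : Fin n, R ^ 2), fun x => ?_⟩, fun x hx => ?_⟩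
  · rw [EuclideanSpace.norm_eq, EuclideanSpace.norm_eq]
    refine Real.sqrt_le_sqrt (Finset.sum_le_sum fun i _ => ?_)
    refine pow_le_pow_left₀ (norm_nonneg _) ?_ 2
    simp only [PiLp.sub_apply, Real.norm_eq_abs]
    rw [max_comm (-R), max_comm (-R), min_comm R, min_comm R]
    exact (abs_max_sub_max_le_abs _ _ _).trans
      ((abs_min_sub_min_le_max _ _ _ _).trans (by simp))
  · rw [EuclideanSpace.norm_eq]
    refine Real.sqrt_le_sqrt (Finset.sum_le_sum fun i _ => ?_)
    refine pow_le_pow_left₀ (norm_nonneg _) ?_ 2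
    rw [Real.norm_eq_abs, abs_le]
    exact ⟨le_max_left _ _, max_le (by linarith) (min_le_left _ _)⟩
  · ext i
    have := abs_le.1 ((PiLp.norm_apply_le x i).trans hx)
    simp [this.1, this.2]

theorem normR_le {r : ℝ} (hr : 0 < r) {n : ℕ} {φ : Hist r n} {C : ℝ} (h : ∀ s, ‖φ s‖ ≤ C) :
    normR φ ≤ C :=
  have : Nonempty (Icc (-r) (0 : ℝ)) := ⟨windowEnd hr⟩
  ciSup_le h

theorem IsPC.norm_sub_le_normR {r : ℝ} {n : ℕ} {φ ψ : Hist r n} (hφ : IsPC φ) (hψ : IsPC ψ)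
    (s : Icc (-r) (0 : ℝ)) : ‖φ s - ψ s‖ ≤ normR (φ - ψ) := by
  obtain ⟨C, hC⟩ := hφ.exists_norm_le
  obtain ⟨C', hC'⟩ := hψ.exists_norm_le
  refine le_ciSup (f := fun s => ‖(φ - ψ) s‖) ⟨C + C', ?_⟩ s
  rintro _ ⟨s, rfl⟩
  exact (norm_sub_le _ _).trans (add_le_add (hC s) (hC' s))

/-- One step of Picard's factorial estimate, by integrating the bound on the derivative. It serves
both the contraction argument and uniqueness. -/
theorem norm_le_pow_succ_div_factorial {E : Type*} [NormedAddCommGroup E] [NormedSpace ℝ E]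
    {D D' : ℝ → E} {T c L M : ℝ} (k : ℕ) (hD : ContinuousOn D (Icc T c))
    (hD' : ∀ t ∈ Ico T c, HasDerivWithinAt D (D' t) (Ici t) t) (h0 : D T = 0)
    (hb : ∀ t ∈ Ico T c, ‖D' t‖ ≤ L * ((L * (t - T)) ^ k / k.factorial * M)) :
    ∀ t ∈ Icc T c, ‖D t‖ ≤ (L * (t - T)) ^ (k + 1) / (k + 1).factorial * M := by
  refine image_norm_le_of_norm_deriv_right_le_deriv_boundary' hD hD' (by simp [h0])
    (by fun_prop) (B' := fun t => L * ((L * (t - T)) ^ k / k.factorial * M)) (fun t _ => ?_) hb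
  have h1 : HasDerivAt (fun t => L * (t - T)) L t := by
    simpa using ((hasDerivAt_id t).sub_const T).const_mul L
  have h2 := ((h1.pow (k + 1)).div_const ((k + 1).factorial : ℝ)).mul_const M
  refine (h2.congr_deriv ?_).hasDerivWithinAt
  have : (k.factorial : ℝ) ≠ 0 := by positivity
  have : (k : ℝ) + 1 ≠ 0 := by positivity
  rw [Nat.factorial_succ]
  push_cast
  field_simp

theorem exists_delay_solution {r : ℝ} (hr : 0 < r) {n : ℕ} {T b : ℝ} (hTb : T < b)
    {G : ℝ → Hist r n → Euc n}
    (hG : ∀ x, PCOn x (Ici (T - r)) → PCOn (fun t => G t (seg r x t)) (Ici T)) {L : ℝ}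
    (hL : 0 ≤ L) (hLip : ∀ t ∈ Icc T b, ∀ φ ψ : Hist r n, IsPC φ → IsPC ψ →
      ‖G t φ - G t ψ‖ ≤ L * normR (φ - ψ)) {φ : Hist r n} (hφ : IsPC φ) :
    ∃ x : ℝ → Euc n, PCOn x (Ici (T - r)) ∧ seg r x T = φ ∧ ContinuousOn x (Icc T b) ∧
      ∀ t ∈ Ico T b, HasDerivWithinAt x (G t (seg r x t)) (Ici t) t := by
  obtain ⟨u, hu, hφu⟩ := hφ.exists_extension T
  -- The unknown lives on `[T, b]` only; the fixed history is prepended to form segments.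
  let ext : C(Icc T b, Euc n) → ℝ → Euc n := fun ξ t =>
    if t < T then u t else IccExtend hTb.le ξ t
  have ext_lt : ∀ ξ t, t < T → ext ξ t = u t := fun ξ t ht => if_pos ht
  have ext_mem : ∀ ξ t (ht : t ∈ Icc T b), ext ξ t = ξ ⟨t, ht⟩ := fun ξ t ht => by
    simp only [ext, if_neg (not_lt.2 ht.1)]
    exact IccExtend_of_mem _ _ ht
  have hext : ∀ ξ, PCOn (ext ξ) (Ici (T - r)) := fun ξ =>
    PCOn.glue (mem_Ici.2 (by linarith)) (hu.mono fun t ht => ⟨ht.1, ht.2⟩)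
      ((PCOn.of_continuousOn (J := Ici T) ξ.continuous.Icc_extend'.continuousOn).mono
        inter_subset_right)
  have hI : ∀ ξ, PCOn (fun t => G t (seg r (ext ξ) t)) (Ici T) := fun ξ => hG _ (hext ξ)
  let Φ : C(Icc T b, Euc n) → C(Icc T b, Euc n) := fun ξ =>
    ⟨fun t => u T + ∫ s in T..t, G s (seg r (ext ξ) s), by
      have := (hI ξ).continuousOn_integral.comp_continuous
        (f := fun t : Icc T b => (t : ℝ)) continuous_subtype_val fun t => t.2.1
      exact continuous_const.add this⟩
  have hΦ : ∀ ξ t, Φ ξ t = u T + ∫ s in T..t, G s (seg r (ext ξ) s) := fun ξ t => rfl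
  have hseg : ∀ ξ, ∀ t ∈ Icc T b, IsPC (seg r (ext ξ) t) := fun ξ t ht =>
    isPC_seg ((hext ξ).mono fun s hs => mem_Ici.2 (by linarith [hs.1, ht.1]))
  have hit : ∀ ξ η (k : ℕ) (t : Icc T b),
      ‖(Φ^[k] ξ) t - (Φ^[k] η) t‖ ≤ (L * (t - T)) ^ k / k.factorial * dist ξ η := by
    intro ξ η k
    induction k with
    | zero => intro t; simpa [dist_eq_norm] using ContinuousMap.dist_apply_le_dist (f := ξ) (g := η) t
    | succ k ih =>
      intro t
      simp only [Function.iterate_succ', Function.comp_apply, hΦ, add_sub_add_left_eq_sub]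
      set ξ' := Φ^[k] ξ
      set η' := Φ^[k] η
      have hc : ∀ ζ, ContinuousOn (fun t => ∫ s in T..t, G s (seg r (ext ζ) s)) (Icc T b) :=
        fun ζ => (hI ζ).continuousOn_integral.mono Icc_subset_Ici_self
      refine norm_le_pow_succ_div_factorial k ((hc ξ').sub (hc η'))
        (fun s hs => ((hI ξ').hasDerivWithinAt_integral le_rfl hs.1).sub
          ((hI η').hasDerivWithinAt_integral le_rfl hs.1)) (by simp) (fun s hs => ?_) t t.2
      have hs' : s ∈ Icc T b := ⟨hs.1, hs.2.le⟩
      refine (hLip s hs' _ _ (hseg _ s hs') (hseg _ s hs')).trans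
        (mul_le_mul_of_nonneg_left (normR_le hr fun σ => ?_) hL)
      have hsT : 0 ≤ L * (s - T) := mul_nonneg hL (sub_nonneg.2 hs.1)
      simp only [Pi.sub_apply, seg]
      -- Two candidates share their history before `T`; after `T` the inductive bound increases in
      -- time, so its value at `s` dominates the whole window.
      rcases lt_or_ge (s + σ) T with h | h
      · rw [ext_lt _ _ h, ext_lt _ _ h, sub_self, norm_zero]
        positivity
      · have hm : s + σ ∈ Icc T b := ⟨h, by linarith [hs.2, σ.2.2]⟩
        rw [ext_mem _ _ hm, ext_mem _ _ hm]
        refine (ih ⟨_, hm⟩).trans ?_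
        have : L * (s + σ - T) ≤ L * (s - T) :=
          mul_le_mul_of_nonneg_left (by linarith [σ.2.2]) hL
        have h0 : 0 ≤ L * (s + σ - T) := mul_nonneg hL (by linarith)
        simp only
        gcongr
  -- Factorials beat powers, so some iterate of `Φ` contracts on all of `[T, b]`, however long; its
  -- fixed point is fixed by `Φ` itself.
  obtain ⟨N, hN⟩ := ((FloorSemiring.tendsto_pow_div_factorial_atTop (L * (b - T))).eventually_lt_const
    one_pos).exists
  have hK0 : 0 ≤ (L * (b - T)) ^ N / N.factorial := by
    have : 0 ≤ L * (b - T) := mul_nonneg hL (by linarith)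
    positivity
  have hcontr : ContractingWith ⟨(L * (b - T)) ^ N / N.factorial, hK0⟩ Φ^[N] := by
    refine ⟨hN, LipschitzWith.of_dist_le_mul fun ξ η => ?_⟩
    refine (ContinuousMap.dist_le (mul_nonneg hK0 dist_nonneg)).2 fun t => ?_
    rw [dist_eq_norm]
    refine (hit ξ η N t).trans ?_
    have : L * (t - T) ≤ L * (b - T) := mul_le_mul_of_nonneg_left (by linarith [t.2.2]) hL
    have h0 : 0 ≤ L * (t - T) := mul_nonneg hL (by linarith [t.2.1])
    change _ ≤ (L * (b - T)) ^ N / N.factorial * dist ξ η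
    gcongr
  set ξ := ContractingWith.fixedPoint Φ^[N] hcontr
  have hfix : Φ ξ = ξ := hcontr.isFixedPt_fixedPoint_iterate
  have hx : EqOn (ext ξ) (fun t => u T + ∫ s in T..t, G s (seg r (ext ξ) s)) (Icc T b) :=
    fun t ht => by
      rw [ext_mem _ _ ht]
      conv_lhs => rw [← hfix]
      rfl
  refine ⟨ext ξ, hext ξ, ?_, ?_, fun t ht => ?_⟩
  · rw [← hφu]
    refine seg_congr fun t ht => ?_
    rcases ht.2.lt_or_eq with h | h
    · exact ext_lt _ _ h
    · rw [h, hx (left_mem_Icc.2 hTb.le)]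
      simp
  · exact (continuousOn_const.add
      ((hI ξ).continuousOn_integral.mono Icc_subset_Ici_self)).congr hx
  · refine (((hI ξ).hasDerivWithinAt_integral le_rfl ht.1).const_add _).congr_of_eventuallyEq ?_
      (hx ⟨ht.1, ht.2.le⟩)
    filter_upwards [Ico_mem_nhdsGE ht.2] with s hs using hx ⟨ht.1.trans hs.1, hs.2.le⟩

theorem IsFlowOn.eqOn {r : ℝ} (hr : 0 < r) {n m : ℕ} {f : ℝ → Hist r n → Euc m → Euc n}
    (hf : RegularRHS f) {w : ℝ → Euc m} {T b : ℝ} {φ : Hist r n} {x y : ℝ → Euc n} (hT : 0 ≤ T)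
    (hφ : IsPC φ) (hw : PCOn w (Ici T)) (hx : IsFlowOn f w T φ b x) (hy : IsFlowOn f w T φ b y) :
    EqOn x y (Ico T b) := by
  intro t ht
  have hTb := ht.1.trans_lt ht.2
  have hsub : Icc (T - r) t ⊆ Ico (T - r) b := fun s hs => ⟨hs.1, hs.2.trans_lt ht.2⟩
  have hxp := (hx.pcOn hr hφ hTb).mono hsub
  have hyp := (hy.pcOn hr hφ hTb).mono hsub
  obtain ⟨C, hC⟩ := hxp.exists_norm_le
  obtain ⟨C', hC'⟩ := hyp.exists_norm_le
  obtain ⟨L, hL⟩ := hf.locally_lipschitz T hT w hw t (max C C')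
  have hTt : Icc T t ⊆ Icc (T - r) t := Icc_subset_Icc_left (by linarith)
  have hinit : EqOn x y (Icc (T - r) T) := eq_of_seg_eq (hx.init.trans hy.init.symm)
  have hM0 : 0 ≤ C + C' := by
    have h1 := hC t (hTt (right_mem_Icc.2 ht.1))
    have h2 := hC' t (hTt (right_mem_Icc.2 ht.1))
    linarith [norm_nonneg (x t), norm_nonneg (y t)]
  -- The factorial bounds hold for every `k` and tend to `0`, which replaces a Grönwall inequality
  -- with delay.
  have key : ∀ k : ℕ, ∀ s ∈ Icc T t,
      ‖x s - y s‖ ≤ (max L 0 * (s - T)) ^ k / k.factorial * (C + C') := by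
    intro k
    induction k with
    | zero =>
      intro s hs
      simpa using (norm_sub_le _ _).trans (add_le_add (hC s (hTt hs)) (hC' s (hTt hs)))
    | succ k ih =>
      have hsub' : Icc T t ⊆ Ico T b := fun s hs => ⟨hs.1, hs.2.trans_lt ht.2⟩
      refine norm_le_pow_succ_div_factorial k ((hx.cont.mono hsub').sub (hy.cont.mono hsub'))
        (fun s hs => (hx.deriv s ⟨hs.1, hs.2.trans ht.2⟩).sub
          (hy.deriv s ⟨hs.1, hs.2.trans ht.2⟩))
        (sub_eq_zero.2 (hinit (right_mem_Icc.2 (by linarith)))) (fun s hs => ?_)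
      have hw' : ∀ σ : Icc (-r) (0 : ℝ), s + σ ∈ Icc (T - r) t := fun σ =>
        ⟨by linarith [hs.1, σ.2.1], by linarith [hs.2, σ.2.2]⟩
      have hss : Icc (s - r) s ⊆ Icc (T - r) t := Icc_subset_Icc (by linarith [hs.1]) hs.2.le
      refine (hL s ⟨hs.1, hs.2.le⟩ _ _ (isPC_seg (hxp.mono hss)) (isPC_seg (hyp.mono hss))
        (fun σ => (hC _ (hw' σ)).trans (le_max_left _ _))
        (fun σ => (hC' _ (hw' σ)).trans (le_max_right _ _))).trans ?_
      have hb : normR (seg r x s - seg r y s) ≤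
          (max L 0 * (s - T)) ^ k / k.factorial * (C + C') := by
        refine normR_le hr fun σ => ?_
        have hsT : 0 ≤ max L 0 * (s - T) :=
          mul_nonneg (le_max_right _ _) (sub_nonneg.2 hs.1)
        simp only [Pi.sub_apply, seg]
        rcases lt_or_ge (s + σ) T with h | h
        · rw [hinit ⟨(hw' σ).1, h.le⟩, sub_self, norm_zero]
          positivity
        · refine (ih _ ⟨h, (hw' σ).2⟩).trans ?_
          have : max L 0 * (s + σ - T) ≤ max L 0 * (s - T) :=
            mul_le_mul_of_nonneg_left (by linarith [σ.2.2]) (le_max_right _ _)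
          have h0 : 0 ≤ max L 0 * (s + σ - T) := mul_nonneg (le_max_right _ _) (by linarith)
          gcongr
      have h0 : 0 ≤ normR (seg r x s - seg r y s) := Real.iSup_nonneg fun σ => norm_nonneg _
      exact (mul_le_mul_of_nonneg_right (le_max_left L 0) h0).trans
        (mul_le_mul_of_nonneg_left hb (le_max_right _ _))
  have hlim := (FloorSemiring.tendsto_pow_div_factorial_atTop (max L 0 * (t - T))).mul_const (C + C')
  rw [zero_mul] at hlim
  have := ge_of_tendsto' hlim fun k => key k t (right_mem_Icc.2 ht.1)
  exact sub_eq_zero.1 (norm_le_zero_iff.1 this)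

/-! ### Flows on arbitrarily long intervals. -/

theorem LyapunovPair.exists_flow {r : ℝ} {hr : 0 < r} {n m : ℕ}
    {f : ℝ → Hist r n → Euc m → Euc n} {V₁ : ℝ → Euc n → ℝ} {V₂ : ℝ → Hist r n → ℝ}
    {α₁ α₂ α₃ χ : ℝ → ℝ} {μ : ℝ} (h : LyapunovPair hr f V₁ V₂ α₁ α₂ α₃ χ μ) (hf : RegularRHS f)
    {w : ℝ → Euc m} {T b : ℝ} {φ : Hist r n} (hT : 0 ≤ T) (hTb : T < b) (hφ : IsPC φ)
    (hw : PCOn w (Ici T)) : ∃ x, IsFlowOn f w T φ b x ∧ ContinuousOn x (Icc T b) := by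
  have hχw := h.pcOn_gain hw
  set X : ℝ → ℝ := fun t => ∫ s in T..t, χ ‖w s‖ with hX
  have hXnn : ∀ t, T ≤ t → 0 ≤ X t := fun t ht =>
    intervalIntegral.integral_nonneg ht fun s _ => h.gain_nonneg _
  have hXmono : ∀ t ∈ Icc T b, X t ≤ X b := fun t ht => by
    rw [hX, ← sub_nonneg]
    simp only
    rw [intervalIntegral.integral_interval_sub_left (hχw.intervalIntegrable_Ici le_rfl hTb.le)
      (hχw.intervalIntegrable_Ici le_rfl ht.1)]
    exact intervalIntegral.integral_nonneg ht.2 fun s _ => h.gain_nonneg _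
  -- `α₁ R₀` exceeds the largest value that the Lyapunov estimate allows on `[T, b]`, so a flow
  -- stays in the ball of radius `R₀`.
  obtain ⟨R₀, hR₀, hR₀0⟩ := ((h.kinf₁.unbounded.eventually_gt_atTop
    (Real.exp (X b) * (V₁ T (φ (windowEnd hr)) + V₂ T φ + Real.exp (μ * (b - T)) * X b))).and
      (eventually_ge_atTop 0)).exists
  have hN0 : 0 ≤ normR φ := Real.iSup_nonneg fun σ => norm_nonneg _
  -- This radius strictly exceeds both `R₀` and the size of the history, so leaving the region where
  -- `P` is the identity takes positive time.
  obtain ⟨P, hP, ⟨C, hC⟩, hPid⟩ := exists_clamp n (R := R₀ + normR φ + 1) (by linarith)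
  have hPc : Continuous P :=
    (LipschitzWith.of_dist_le_mul (K := 1) fun x y => by simpa [dist_eq_norm] using hP x y).continuous
  obtain ⟨L, hL⟩ := hf.locally_lipschitz T hT w hw b C
  obtain ⟨x, hxp, hx0, hxc, hxd⟩ := exists_delay_solution hr hTb
    (G := fun t ψ => f t (fun s => P (ψ s)) (w t)) (L := max L 0)
    (fun x hx => hf.composite_pc T hT w hw _ (hx.continuous_comp hPc)) (le_max_right _ _)
    (fun t ht ψ ψ' hψ hψ' => by
      refine (hL t ht _ _ (hψ.continuous_comp hPc) (hψ'.continuous_comp hPc) (fun s => hC _)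
        (fun s => hC _)).trans ((mul_le_mul_of_nonneg_right (le_max_left L 0)
          (Real.iSup_nonneg fun σ => norm_nonneg _)).trans
          (mul_le_mul_of_nonneg_left (normR_le hr fun s => ?_) (le_max_right _ _)))
      exact (hP _ _).trans (hψ.norm_sub_le_normR hψ' s)) hφ
  have hseg0 : ∀ s, T - r ≤ s → s ≤ T → ‖x s‖ ≤ normR φ := fun s h1 h2 => by
    have := hφ.norm_le_normR ⟨s - T, by linarith, by linarith⟩
    rw [← hx0] at this
    simpa [seg, hx0] using this
  have hflow : ∀ c, T < c → c ≤ b → (∀ s ∈ Ico T c, ‖x s‖ < R₀ + normR φ + 1) →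
      IsFlowOn f w T φ c x := fun c hTc hcb hlt => by
    refine ⟨hx0, hxc.mono fun s hs => ⟨hs.1, hs.2.le.trans hcb⟩, fun s hs => ?_⟩
    have hd := hxd s ⟨hs.1, hs.2.trans_le hcb⟩
    have heq : (fun σ => P (seg r x s σ)) = seg r x s := by
      funext σ
      refine hPid _ ?_
      rcases lt_or_ge (s + σ) T with h' | h'
      · exact (hseg0 _ (by linarith [hs.1, σ.2.1]) h'.le).trans (by linarith)
      · exact (hlt _ ⟨h', by linarith [hs.2, σ.2.2]⟩).le
    simpa only [heq] using hd
  refine ⟨x, hflow b hTb le_rfl ?_, hxc⟩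
  by_contra hcon
  push Not at hcon
  obtain ⟨s₀, hs₀, hs₀R⟩ := hcon
  have hcl : IsClosed (Icc T b ∩ (fun s => ‖x s‖) ⁻¹' Ici (R₀ + normR φ + 1)) :=
    hxc.norm.preimage_isClosed_of_isClosed isClosed_Icc isClosed_Ici
  -- Let `c` be the first time at which the clamping radius is reached. Up to `c` the truncated
  -- solution is a true flow, hence bounded by `R₀`; by continuity so is its value at `c`, a
  -- contradiction.
  obtain ⟨c, ⟨hc, hcR⟩, hmin⟩ := (isCompact_Icc.of_isClosed_subset hcl
    inter_subset_left).exists_isLeast ⟨s₀, ⟨hs₀.1, hs₀.2.le⟩, hs₀R⟩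
  have hcR : R₀ + normR φ + 1 ≤ ‖x c‖ := hcR
  have hTc : T < c := by
    refine lt_of_le_of_ne hc.1 fun heq => ?_
    have := hseg0 T (by linarith) le_rfl
    rw [← heq] at hcR
    linarith
  have hfc := hflow c hTc hc.2 fun s hs => by
    by_contra hge
    exact absurd (hmin ⟨⟨hs.1, hs.2.le.trans hc.2⟩, mem_Ici.2 (not_lt.1 hge)⟩) (not_le.2 hs.2)
  have hbd : ∀ s ∈ Ico T c, ‖x s‖ ≤ R₀ := fun s hs => by
    have hsb : s ∈ Icc T b := ⟨hs.1, hs.2.le.trans hc.2⟩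
    have h1 := h.lyap_le hT hφ hw hfc hs
    have hpc : IsPC (seg r x s) := isPC_seg (hxp.mono fun σ hσ =>
      mem_Ici.2 (by linarith [hσ.1, hs.1]))
    have h2 : α₁ ‖x s‖ ≤ lyap V₁ V₂ x s := by
      have ha := (h.bounds₁ s (by linarith [hs.1]) (x s)).1
      have hb := (h.bounds₂ s (hT.trans hs.1) _ hpc).1
      simp only [lyap]
      linarith
    have h3 : lyap V₁ V₂ x T = V₁ T (φ (windowEnd hr)) + V₂ T φ := by
      rw [lyap, hx0, ← hx0]
      simp [seg, windowEnd]
    have h0 : 0 ≤ V₁ T (φ (windowEnd hr)) + V₂ T φ :=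
      add_nonneg (h.nu.nonneg T hT _) (h.bounds₂ T hT φ hφ).1
    have h4 : Real.exp (-μ * (s - T)) * Real.exp (X s) *
        (lyap V₁ V₂ x T + Real.exp (μ * (s - T)) * X s) ≤
        Real.exp (X b) * (V₁ T (φ (windowEnd hr)) + V₂ T φ + Real.exp (μ * (b - T)) * X b) := by
      rw [h3]
      have hμ := h.rate_pos
      have e1 : Real.exp (-μ * (s - T)) ≤ 1 := Real.exp_le_one_iff.2
        (by nlinarith [hs.1])
      have e2 : Real.exp (X s) ≤ Real.exp (X b) := Real.exp_le_exp.2 (hXmono s hsb)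
      have e3 : Real.exp (μ * (s - T)) ≤ Real.exp (μ * (b - T)) :=
        Real.exp_le_exp.2 (by nlinarith [hsb.2])
      have e4 := hXmono s hsb
      have e5 := hXnn s hs.1
      calc _ ≤ 1 * Real.exp (X b) * (V₁ T (φ (windowEnd hr)) + V₂ T φ +
            Real.exp (μ * (b - T)) * X b) := by gcongr
        _ = _ := by rw [one_mul]
    by_contra hlt
    have := h.kinf₁.toClassK.mono hR₀0 (not_le.1 hlt).le
    linarith
  have hle : ‖x c‖ ≤ R₀ := by
    have ht : Tendsto (fun s => ‖x s‖) (𝓝[Ico T c] c) (𝓝 ‖x c‖) :=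
      ((hxc c hc).mono fun s hs => ⟨hs.1, hs.2.le.trans hc.2⟩).norm
    rw [nhdsWithin_Ico_eq_nhdsLT hTc] at ht
    refine le_of_tendsto ht ?_
    filter_upwards [Ico_mem_nhdsLT hTc] with s hs using hbd s hs
  linarith

/-! ### Solutions of the impulsive system. -/

/-- Convergence is assumed because `Function.leftLim` defaults to the value at the point when there
is no left limit. -/
theorem leftLim_congr {E : Type*} [TopologicalSpace E] [T2Space E] {x y : ℝ → E} {c t : ℝ}
    (h : Tendsto x (𝓝[<] t) (𝓝 (Function.leftLim x t))) (hc : c < t) (hxy : EqOn y x (Ioo c t)) :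
    Function.leftLim y t = Function.leftLim x t :=
  leftLim_eq_of_tendsto <| h.congr' <| by
    filter_upwards [Ioo_mem_nhdsLT hc] with s hs using (hxy hs).symm

theorem segLeft_congr {r : ℝ} {n : ℕ} {x y : ℝ → Euc n} {t : ℝ} (h : EqOn y x (Ico (t - r) t))
    (hl : Function.leftLim y t = Function.leftLim x t) : segLeft r y t = segLeft r x t := by
  funext s
  simp only [segLeft, hl]
  split_ifs with hs
  · exact h ⟨by linarith [s.2.1], by linarith⟩
  · rfl

namespace IsSolutionOn

variable {r : ℝ} {n m : ℕ} {f : ℝ → Hist r n → Euc m → Euc n}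
    {I : ℕ → ℝ → Hist r n → Euc m → Euc n} {τ : ℕ → ℝ} {w : ℝ → Euc m} {t₀ : ℝ} {φ : Hist r n}

theorem tendsto_leftLim (hr : 0 < r) {J : Set ℝ} {x : ℝ → Euc n}
    (h : IsSolutionOn f I τ w t₀ φ J x) {c t : ℝ} (hJ : Ico t₀ c ⊆ J) (ht : t ∈ Ico t₀ c) :
    Tendsto x (𝓝[<] t) (𝓝 (Function.leftLim x t)) := by
  refine h.pc.tendsto_leftLim (Or.inr (hJ ht)) (c := t - r) (by linarith) fun s hs => ?_
  rcases le_or_gt s t₀ with h' | h'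
  · exact Or.inl ⟨by linarith [hs.1, ht.1], h'⟩
  · exact Or.inr (hJ ⟨h'.le, hs.2.trans ht.2⟩)

theorem mono {J J' : Set ℝ} {x : ℝ → Euc n} (h : IsSolutionOn f I τ w t₀ φ J x) (hJ : J' ⊆ J) :
    IsSolutionOn f I τ w t₀ φ J' x where
  pc := h.pc.mono (union_subset_union_right _ hJ)
  init := h.init
  cont t ht := h.cont t (hJ ht)
  deriv t ht := h.deriv t (hJ ht)
  jump k hk hm := h.jump k hk (hJ hm)

theorem union_eq (hr : 0 < r) {c : ℝ} (hc : t₀ < c) :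
    Icc (t₀ - r) t₀ ∪ Ico t₀ c = Ico (t₀ - r) c :=
  Icc_union_Ico_eq_Ico (by linarith) hc

/-- Being a solution on `[t₀, c)` depends only on the values on `[t₀ - r, c)`. -/
theorem congr (hr : 0 < r) {c : ℝ} (hc : t₀ < c) {x y : ℝ → Euc n}
    (h : IsSolutionOn f I τ w t₀ φ (Ico t₀ c) x) (hyx : EqOn y x (Ico (t₀ - r) c)) (h0 : τ 0 = t₀)
    (hτ : StrictMono τ) : IsSolutionOn f I τ w t₀ φ (Ico t₀ c) y where
  pc := by
    have := h.pc
    rw [union_eq hr hc] at this ⊢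
    exact this.congr hyx
  init := by
    rw [← h.init]
    exact seg_congr (fun s hs => hyx ⟨hs.1, hs.2.trans_lt hc⟩)
  cont t ht ht0 hk := (h.cont t ht ht0 hk).congr <| by
    filter_upwards [Ioo_mem_nhds ht0 ht.2] with s hs
      using (hyx ⟨by linarith [hs.1], hs.2⟩).symm
  deriv t ht := by
    rw [seg_congr (fun s hs => hyx ⟨by linarith [hs.1, ht.1], hs.2.trans_lt ht.2⟩)]
    refine (h.deriv t ht).congr_of_eventuallyEq ?_ (hyx ⟨by linarith [ht.1], ht.2⟩)
    filter_upwards [Ico_mem_nhdsGE ht.2] with s hs using hyx ⟨by linarith [ht.1, hs.1], hs.2⟩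
  jump k hk hm := by
    have hlt : t₀ < τ k := h0 ▸ hτ hk
    have hl := leftLim_congr (h.tendsto_leftLim hr Subset.rfl hm) hlt
      (fun s hs => hyx ⟨by linarith [hs.1], hs.2.trans hm.2⟩)
    rw [hyx ⟨by linarith, hm.2⟩, hl, segLeft_congr
      (fun s hs => hyx ⟨by linarith [hs.1], hs.2.trans hm.2⟩) hl]
    exact h.jump k hk hm

theorem isFlowOn {J : Set ℝ} {x : ℝ → Euc n} (h : IsSolutionOn f I τ w t₀ φ J x) (h0 : τ 0 = t₀)
    (hτ : StrictMono τ) {k : ℕ} {c : ℝ} (hc : c ≤ τ (k + 1)) (hJ : Ico (τ k) c ⊆ J) :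
    IsFlowOn f w (τ k) (seg r x (τ k)) c x where
  init := rfl
  cont t ht := by
    -- At `τ k` continuity from within `[τ k, c)` comes from the right derivative, so a jump there
    -- does no harm.
    rcases ht.1.eq_or_lt with h' | h'
    · refine (h.deriv t (hJ ht)).continuousWithinAt.mono fun s hs => ?_
      exact mem_Ici.2 (h' ▸ hs.1)
    · refine (h.cont t (hJ ht) ?_ fun j _ hj => ?_).continuousWithinAt
      · exact lt_of_le_of_lt (h0 ▸ hτ.monotone (Nat.zero_le k)) h'
      · have h1 := hτ.lt_iff_lt.1 (hj ▸ h')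
        have h2 := hτ.lt_iff_lt.1 (hj ▸ ht.2.trans_le hc)
        omega
  deriv t ht := h.deriv t (hJ ht)

/-- A solution on `[t₀, τ (k + 1))` is continued by a jump and a flow. -/
theorem extend {k : ℕ} {b : ℝ} {x : ℝ → Euc n}
    (h : IsSolutionOn f I τ w t₀ φ (Ico t₀ (τ (k + 1))) x)
    (hτ : StrictMono τ) (hb : b ≤ τ (k + 2)) (hpc : PCOn x (Icc (t₀ - r) t₀ ∪ Ico t₀ b))
    (hx : IsFlowOn f w (τ (k + 1)) (seg r x (τ (k + 1))) b x)
    (hj : x (τ (k + 1)) = Function.leftLim x (τ (k + 1)) + I (k + 1) (τ (k + 1))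
      (segLeft r x (τ (k + 1))) (Function.leftLim w (τ (k + 1)))) :
    IsSolutionOn f I τ w t₀ φ (Ico t₀ b) x where
  pc := hpc
  init := h.init
  cont t ht ht0 hk := by
    rcases lt_trichotomy t (τ (k + 1)) with h' | h' | h'
    · exact h.cont t ⟨ht.1, h'⟩ ht0 hk
    · exact absurd h' (hk _ (by omega))
    · exact hx.cont.continuousAt (Ico_mem_nhds h' ht.2)
  deriv t ht := by
    rcases lt_or_ge t (τ (k + 1)) with h' | h'
    · exact h.deriv t ⟨ht.1, h'⟩
    · exact hx.deriv t ⟨h', ht.2⟩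
  jump j hj1 hjm := by
    have : j < k + 2 := hτ.lt_iff_lt.1 (hjm.2.trans_le hb)
    rcases (show j < k + 1 ∨ j = k + 1 by omega) with h' | rfl
    · exact h.jump j hj1 ⟨hjm.1, hτ h'⟩
    · exact hj

theorem eqOn (hr : 0 < r) (hf : RegularRHS f) (ht₀ : 0 ≤ t₀) (h0 : τ 0 = t₀) (hτ : StrictMono τ)
    (hτ' : Tendsto τ atTop atTop) (hw : PCOn w (Ici t₀)) {b : ℝ} {x y : ℝ → Euc n}
    (hx : IsSolutionOn f I τ w t₀ φ (Ico t₀ b) x) (hy : IsSolutionOn f I τ w t₀ φ (Ico t₀ b) y) :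
    EqOn y x (Ico t₀ b) := by
  rcases le_or_gt b t₀ with hb | hb
  · simp [Ico_eq_empty (not_lt.2 hb)]
  have hge : ∀ k, t₀ ≤ τ k := fun k => h0 ▸ hτ.monotone (Nat.zero_le k)
  have flow : ∀ k, τ k < b → seg r y (τ k) = seg r x (τ k) →
      EqOn y x (Ico (τ k) (min b (τ (k + 1)))) := fun k hkb hseg => by
    have hJ : Ico (τ k) (min b (τ (k + 1))) ⊆ Ico t₀ b :=
      Ico_subset_Ico (hge k) (min_le_left _ _)
    have hpc : IsPC (seg r x (τ k)) := isPC_seg <| hx.pc.mono <| by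
      rw [union_eq hr hb]
      exact fun s hs => ⟨by linarith [hs.1, hge k], hs.2.trans_lt hkb⟩
    have hyf := hy.isFlowOn h0 hτ (min_le_right _ _) hJ
    rw [hseg] at hyf
    exact hyf.eqOn hr hf (ht₀.trans (hge k)) hpc (hw.mono (Ici_subset_Ici.2 (hge k)))
      (hx.isFlowOn h0 hτ (min_le_right _ _) hJ)
  have key : ∀ k, EqOn y x (Ico (t₀ - r) (min b (τ (k + 1)))) := by
    intro k
    induction k with
    | zero =>
      intro t ht
      rcases le_or_gt t t₀ with h | h
      · exact eq_of_seg_eq (hy.init.trans hx.init.symm) ⟨ht.1, h⟩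
      · exact flow 0 (h0 ▸ hb) (by rw [h0, hy.init, hx.init]) ⟨h0.symm ▸ h.le, ht.2⟩
    | succ k ih =>
      rcases le_or_gt b (τ (k + 1)) with h | h
      · rw [min_eq_left h] at ih
        exact ih.mono (Ico_subset_Ico_right (min_le_left _ _))
      rw [min_eq_right h.le] at ih
      have hlt : t₀ < τ (k + 1) := h0 ▸ hτ (Nat.succ_pos k)
      have hl : Function.leftLim y (τ (k + 1)) = Function.leftLim x (τ (k + 1)) :=
        leftLim_congr (hx.tendsto_leftLim hr Subset.rfl ⟨hlt.le, h⟩) hlt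
          (fun s hs => ih ⟨by linarith [hs.1], hs.2⟩)
      have hT : y (τ (k + 1)) = x (τ (k + 1)) := by
        rw [hy.jump (k + 1) (by omega) ⟨hlt.le, h⟩, hx.jump (k + 1) (by omega) ⟨hlt.le, h⟩, hl,
          segLeft_congr (fun s hs => ih ⟨by linarith [hs.1], hs.2⟩) hl]
      have hle : EqOn y x (Icc (t₀ - r) (τ (k + 1))) := fun s hs => by
        rcases hs.2.lt_or_eq with h' | h'
        · exact ih ⟨hs.1, h'⟩
        · rw [h', hT]
      intro t ht
      rcases le_or_gt t (τ (k + 1)) with h' | h'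
      · exact hle ⟨ht.1, h'⟩
      · exact flow (k + 1) h (seg_congr (fun s hs => hle ⟨by linarith [hs.1], hs.2⟩))
          ⟨h'.le, ht.2⟩
  intro t ht
  obtain ⟨k, hk⟩ := ((hτ'.comp (tendsto_add_atTop_nat 1)).eventually_gt_atTop t).exists
  exact key k ⟨by linarith [ht.1], lt_min ht.2 hk⟩

theorem of_forall_Ico (hr : 0 < r) (h0 : τ 0 = t₀) (hτ : StrictMono τ)
    (hτ' : Tendsto τ atTop atTop) {x : ℝ → Euc n}
    (h : ∀ k, IsSolutionOn f I τ w t₀ φ (Ico t₀ (τ (k + 1))) x) :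
    IsSolutionOn f I τ w t₀ φ (Ici t₀) x := by
  have hex : ∀ t, ∃ k, t < τ (k + 1) := fun t =>
    ((hτ'.comp (tendsto_add_atTop_nat 1)).eventually_gt_atTop t).exists
  have hlt : ∀ k, t₀ < τ (k + 1) := fun k => h0 ▸ hτ (Nat.succ_pos k)
  have hU : Icc (t₀ - r) t₀ ∪ Ici t₀ = Ici (t₀ - r) :=
    Icc_union_Ici_eq_Ici (by linarith)
  have hpc : ∀ k, PCOn x (Ico (t₀ - r) (τ (k + 1))) := fun k => union_eq hr (hlt k) ▸ (h k).pc
  refine ⟨?_, (h 0).init, fun t ht => ?_, fun t ht => ?_, fun j hj hm => ?_⟩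
  · rw [hU]
    refine ⟨fun t ht => ?_, fun t ht => ?_, fun a ha b hb => ?_⟩
    · obtain ⟨k, hk⟩ := hex t
      refine ((hpc k).right_cont t ⟨ht, hk⟩).mono_of_mem_nhdsWithin ?_
      filter_upwards [self_mem_nhdsWithin, mem_nhdsWithin_of_mem_nhds (Iio_mem_nhds hk)]
        with s hs hs' using ⟨⟨hs.1, hs'⟩, hs.2⟩
    · obtain ⟨k, hk⟩ := hex t
      obtain ⟨l, hl⟩ := (hpc k).left_lim t ⟨ht, hk⟩
      exact ⟨l, hl.mono_left (nhdsWithin_mono _ fun s hs =>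
        ⟨⟨hs.1, lt_trans (mem_Iio.1 hs.2) hk⟩, hs.2⟩)⟩
    · obtain ⟨k, hk⟩ := hex (max a b)
      refine ((hpc k).finite_disc a ⟨ha, (le_max_left _ _).trans_lt hk⟩ b
        ⟨hb, (le_max_right _ _).trans_lt hk⟩).subset fun t ht => ⟨ht.1, fun hc => ht.2 ?_⟩
      refine hc.mono_of_mem_nhdsWithin ?_
      filter_upwards [self_mem_nhdsWithin, mem_nhdsWithin_of_mem_nhds
        (Iio_mem_nhds (ht.1.2.trans_lt ((le_max_right _ _).trans_lt hk)))] with s hs hs'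
        using ⟨hs, hs'⟩
  · obtain ⟨k, hk⟩ := hex t
    exact (h k).cont t ⟨ht, hk⟩
  · obtain ⟨k, hk⟩ := hex t
    exact (h k).deriv t ⟨ht, hk⟩
  · exact (h j).jump j hj ⟨hm, hτ (Nat.lt_succ_self j)⟩

end IsSolutionOn

theorem LyapunovPair.exists_solution {r : ℝ} {hr : 0 < r} {n m : ℕ}
    {f : ℝ → Hist r n → Euc m → Euc n} {V₁ : ℝ → Euc n → ℝ} {V₂ : ℝ → Hist r n → ℝ}
    {α₁ α₂ α₃ χ : ℝ → ℝ} {μ : ℝ} (h : LyapunovPair hr f V₁ V₂ α₁ α₂ α₃ χ μ) (hf : RegularRHS f)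
    (I : ℕ → ℝ → Hist r n → Euc m → Euc n) {τ : ℕ → ℝ} {w : ℝ → Euc m} {t₀ : ℝ} {φ : Hist r n}
    (ht₀ : 0 ≤ t₀) (h0 : τ 0 = t₀) (hτ : StrictMono τ) (hτ' : Tendsto τ atTop atTop)
    (hφ : IsPC φ) (hw : PCOn w (Ici t₀)) : ∃ x, IsSolutionOn f I τ w t₀ φ (Ici t₀) x := by
  have hge : ∀ k, t₀ ≤ τ k := fun k => h0 ▸ hτ.monotone (Nat.zero_le k)
  have hlt : ∀ k, t₀ < τ (k + 1) := fun k => h0 ▸ hτ (Nat.succ_pos k)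
  -- Being `PC` up to the closed endpoint secures the left limit at `τ (k + 1)`, from which the next
  -- jump starts.
  let Good : ℕ → (ℝ → Euc n) → Prop := fun k x =>
    IsSolutionOn f I τ w t₀ φ (Ico t₀ (τ (k + 1))) x ∧ PCOn x (Icc (t₀ - r) (τ (k + 1)))
  have base : ∃ x, Good 0 x := by
    obtain ⟨x, hx, hxc⟩ := h.exists_flow hf ht₀ (hlt 0) hφ hw
    obtain ⟨u, hu, hφu⟩ := hφ.exists_extension t₀
    have hpc : PCOn x (Icc (t₀ - r) (τ 1)) := by
      have hg : PCOn (fun t => if t < t₀ then u t else x t) (Icc (t₀ - r) (τ 1)) :=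
        PCOn.glue ⟨by linarith, hge 1⟩ (hu.mono fun t ht => ⟨ht.1.1, ht.2⟩)
          ((PCOn.of_continuousOn hxc).mono fun t ht => ⟨ht.2, ht.1.2⟩)
      refine hg.congr fun t ht => ?_
      rcases lt_or_ge t t₀ with h' | h'
      · simp only [h', if_true]
        exact eq_of_seg_eq (hx.init.trans hφu.symm) ⟨ht.1, h'.le⟩
      · simp [not_lt.2 h']
    refine ⟨x, ⟨hpc.mono ?_, hx.init, fun t ht ht0 _ => ?_, hx.deriv, fun k hk hm => ?_⟩, hpc⟩
    · rw [IsSolutionOn.union_eq hr (hlt 0)]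
      exact Ico_subset_Icc_self
    · exact hx.cont.continuousAt (Ico_mem_nhds ht0 ht.2)
    · have := hτ.lt_iff_lt.1 hm.2
      omega
  have step : ∀ k x, Good k x → ∃ y, Good (k + 1) y ∧ EqOn y x (Iio (τ (k + 1))) := by
    rintro k x ⟨hx, hxpc⟩
    set T := τ (k + 1) with hT
    have hTb : T < τ (k + 2) := hτ (Nat.lt_succ_self _)
    have hxl : Tendsto x (𝓝[<] T) (𝓝 (Function.leftLim x T)) :=
      hxpc.tendsto_leftLim ⟨by linarith [hlt k], le_rfl⟩ (hlt k)
        fun s hs => ⟨by linarith [hs.1], hs.2.le⟩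
    set v := Function.leftLim x T + I (k + 1) T (segLeft r x T) (Function.leftLim w T)
    have hz : PCOn (fun t => if t < T then x t else v) (Icc (T - r) T) :=
      PCOn.glue ⟨by linarith, le_rfl⟩ (hxpc.mono fun t ht => ⟨by linarith [ht.1.1, hlt k], ht.2⟩)
        (PCOn.of_continuousOn (J := Ici T) continuousOn_const |>.mono inter_subset_right)
    obtain ⟨y, hy, hyc⟩ := h.exists_flow hf (ht₀.trans (hge _)) hTb (isPC_seg hz)
      (hw.mono (Ici_subset_Ici.2 (hge _)))
    have hyz := eq_of_seg_eq hy.init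
    have hyT : y T = v := (hyz ⟨by linarith, le_rfl⟩).trans (if_neg (lt_irrefl T))
    set X : ℝ → Euc n := fun t => if t < T then x t else y t
    have hXx : EqOn X x (Iio T) := fun t ht => if_pos ht
    have hXy : EqOn X y (Ici (T - r)) := fun t ht => by
      rcases lt_or_ge t T with h' | h'
      · exact (if_pos h').trans ((hyz ⟨ht, h'.le⟩).trans (if_pos h')).symm
      · exact if_neg (not_lt.2 h')
    have hXpc : PCOn X (Icc (t₀ - r) (τ (k + 2))) :=
      PCOn.glue ⟨by linarith [hlt k], hTb.le⟩ (hxpc.mono fun t ht => ⟨ht.1.1, ht.2⟩)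
        ((PCOn.of_continuousOn hyc).mono fun t ht => ⟨ht.2, ht.1.2⟩)
    have hXflow : IsFlowOn f w T (seg r X T) (τ (k + 2)) X := by
      refine ⟨rfl, hy.cont.congr fun t ht => hXy (mem_Ici.2 (by linarith [ht.1])), fun t ht => ?_⟩
      rw [seg_congr (hXy.mono fun s hs => mem_Ici.2 (by linarith [hs.1, ht.1]))]
      exact (hy.deriv t ht).congr
        (fun s hs => hXy (mem_Ici.2 (by linarith [ht.1, mem_Ici.1 hs])))
        (hXy (mem_Ici.2 (by linarith [ht.1])))
    have hl : Function.leftLim X T = Function.leftLim x T :=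
      leftLim_congr hxl (hlt k) (hXx.mono fun s hs => hs.2)
    refine ⟨X, ⟨IsSolutionOn.extend (k := k) ?_ hτ le_rfl (hXpc.mono ?_) hXflow ?_, hXpc⟩, hXx⟩
    · exact hx.congr hr (hlt k) (hXx.mono fun s hs => hs.2) h0 hτ
    · rw [IsSolutionOn.union_eq hr (hlt (k + 1))]
      exact Ico_subset_Icc_self
    · rw [← hT, hl, segLeft_congr (hXx.mono fun s hs => hs.2) hl, hXy (mem_Ici.2 (by linarith)),
        hyT]
  obtain ⟨x₀, hx₀⟩ := base
  choose! g hg hgeq using step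
  let S : ℕ → ℝ → Euc n := fun k => Nat.rec x₀ g k
  have hS : ∀ k, Good k (S k) := fun k => by
    induction k with
    | zero => exact hx₀
    | succ k ih => exact hg k _ ih
  have hSeq : ∀ k j, k ≤ j → EqOn (S j) (S k) (Iio (τ (k + 1))) := fun k j hkj => by
    induction j, hkj using Nat.le_induction with
    | base => exact fun _ _ => rfl
    | succ j hj ih =>
      exact ((hgeq j _ (hS j)).mono
        (Iio_subset_Iio (hτ.monotone (by omega)))).trans ih
  have hex : ∀ t, ∃ k, t < τ (k + 1) := fun t =>
    ((hτ'.comp (tendsto_add_atTop_nat 1)).eventually_gt_atTop t).exists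
  choose N hN using hex
  -- Stage `k` is final below `τ (k + 1)`, so the limit may be read off at any stage reaching past
  -- `t`.
  refine ⟨fun t => S (N t) t, IsSolutionOn.of_forall_Ico hr h0 hτ hτ' fun k =>
    (hS k).1.congr hr (hlt k) (fun t ht => ?_) h0 hτ⟩
  rcases le_total k (N t) with h' | h'
  · exact hSeq k _ h' ht.2
  · exact (hSeq _ _ h' (hN t)).symm

/-! ### Comparison functions, counting of impulses, and the logarithm. -/

namespace ClassK

theorem add {α β : ℝ → ℝ} (hα : ClassK α) (hβ : ClassK β) : ClassK fun s => α s + β s where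
  cont := hα.cont.add hβ.cont
  strictMono _ hs _ ht hst := add_lt_add (hα.strictMono hs ht hst) (hβ.strictMono hs ht hst)
  zero := by simp [hα.zero, hβ.zero]

theorem const_mul {α : ℝ → ℝ} (hα : ClassK α) {c : ℝ} (hc : 0 < c) : ClassK fun s => c * α s where
  cont := hα.cont.const_mul c
  strictMono _ hs _ ht hst := mul_lt_mul_of_pos_left (hα.strictMono hs ht hst) hc
  zero := by simp [hα.zero]

theorem classKL_exp_mul {α : ℝ → ℝ} (hα : ClassK α) {c : ℝ} (hc : 0 < c) :
    ClassKL fun s t => Real.exp (-c * t) * α s where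
  cont := by
    refine ContinuousOn.mul (by fun_prop) ?_
    exact hα.cont.comp continuousOn_fst fun p hp => hp.1
  classK t _ := hα.const_mul (Real.exp_pos _)
  anti s hs t _ u _ htu := mul_le_mul_of_nonneg_right
    (Real.exp_le_exp.2 (by nlinarith)) (hα.nonneg hs)
  tendsto s _ := by
    have h1 : Tendsto (fun t : ℝ => -c * t) atTop atBot :=
      tendsto_id.const_mul_atTop_of_neg (by linarith)
    simpa using (Real.tendsto_exp_atBot.comp h1).mul_const (α s)

end ClassK

theorem ClassKInf.const_mul {α : ℝ → ℝ} (hα : ClassKInf α) {c : ℝ} (hc : 0 < c) :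
    ClassKInf fun s => c * α s :=
  ⟨hα.toClassK.const_mul hc, hα.unbounded.const_mul_atTop hc⟩

theorem ClassKInf.log_one_add {α : ℝ → ℝ} (hα : ClassKInf α) :
    ClassKInf fun s => Real.log (1 + α s) where
  cont := (continuousOn_const.add hα.cont).log fun s hs => by
    have := hα.toClassK.nonneg hs
    exact (by linarith : 0 < 1 + α s).ne'
  strictMono s hs t ht hst := Real.log_lt_log (by linarith [hα.toClassK.nonneg hs])
    (by linarith [hα.strictMono hs ht hst])
  zero := by simp [hα.zero]
  unbounded := Real.tendsto_log_atTop.comp (tendsto_atTop_add_const_left _ 1 hα.unbounded)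

theorem finsum_mem_impulses {τ : ℕ → ℝ} (hτ : StrictMono τ) {k : ℕ} {t : ℝ}
    (ht : t ∈ Ico (τ k) (τ (k + 1))) (g : ℕ → ℝ) :
    ∑ᶠ j ∈ {j : ℕ | τ 0 < τ j ∧ τ j ≤ t}, g j = ∑ j ∈ Finset.Icc 1 k, g j := by
  have : {j : ℕ | τ 0 < τ j ∧ τ j ≤ t} = ↑(Finset.Icc 1 k) := by
    ext j
    simp only [mem_ofPred_eq, Finset.coe_Icc, mem_Icc, hτ.lt_iff_lt]
    refine and_congr_right fun _ => ⟨fun h => ?_, fun h => (hτ.monotone h).trans ht.1⟩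
    have := hτ.lt_iff_lt.1 (h.trans_lt ht.2)
    omega
  rw [this, finsum_mem_coe_finset]

theorem exists_mem_Ico_impulses {τ : ℕ → ℝ} (hτ' : Tendsto τ atTop atTop) {t : ℝ}
    (ht : τ 0 ≤ t) : ∃ k, t ∈ Ico (τ k) (τ (k + 1)) := by
  by_contra! hcon
  have h1 : ∀ k, τ k ≤ t := fun k => by
    induction k with
    | zero => exact ht
    | succ k ih => exact not_lt.1 fun h => hcon k ⟨ih, h⟩
  obtain ⟨k, hk⟩ := (hτ'.eventually_gt_atTop t).exists
  exact absurd (h1 k) (not_le.2 hk)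

/-- This turns the multiplicative effect of the input into an additive one: `1 + e^X b ≤ e^X (1 +
b)` and `log (1 + b) ≤ b`. -/
theorem log_one_add_le_of_le_exp_mul {v X b : ℝ} (hv : 0 ≤ v) (hX : 0 ≤ X) (hb : 0 ≤ b)
    (h : v ≤ Real.exp X * b) : Real.log (1 + v) ≤ X + b := by
  have h1 : 1 + v ≤ Real.exp X * (1 + b) := by linarith [Real.one_le_exp hX]
  calc Real.log (1 + v) ≤ Real.log (Real.exp X * (1 + b)) := Real.log_le_log (by linarith) h1
    _ = X + Real.log (1 + b) := by
      rw [Real.log_mul (Real.exp_pos _).ne' (by linarith), Real.log_exp]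
    _ ≤ X + b := by linarith [Real.log_le_sub_one_of_pos (show 0 < 1 + b by linarith)]

/-! ### Effect of a single jump, and the envelope. -/

/-- The jumps increase the Lyapunov functional by at most the factors `ρ` (of its left limit) and
`c` (of the supremum of `V₁` over the delay window). -/
def JumpBound {r : ℝ} (hr : 0 < r) {n m : ℕ} (I : ℕ → ℝ → Hist r n → Euc m → Euc n)
    (V₁ : ℝ → Euc n → ℝ) (V₂ : ℝ → Hist r n → ℝ) (χ : ℝ → ℝ) (ρ c : ℝ) : Prop :=
  ∀ k, 1 ≤ k → ∀ t, 0 ≤ t → ∀ φ : Hist r n, IsPC φ → ∀ y : Euc m,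
    V₁ t (φ (windowEnd hr) + I k t φ y) + V₂ t φ ≤
      ρ * (V₁ t (φ (windowEnd hr)) + V₂ t φ) +
        c * (⨆ s : Icc (-r) (0 : ℝ), V₁ (t + s) (φ s)) + χ ‖y‖

namespace LyapunovPair

variable {r : ℝ} {hr : 0 < r} {n m : ℕ} {f : ℝ → Hist r n → Euc m → Euc n}
    {V₁ : ℝ → Euc n → ℝ} {V₂ : ℝ → Hist r n → ℝ} {α₁ α₂ α₃ χ : ℝ → ℝ} {μ : ℝ}

theorem le_lyap (h : LyapunovPair hr f V₁ V₂ α₁ α₂ α₃ χ μ) {x : ℝ → Euc n} {t : ℝ} (ht : 0 ≤ t)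
    (hx : PCOn x (Icc (t - r) t)) : V₁ t (x t) ≤ lyap V₁ V₂ x t := by
  have := (h.bounds₂ t ht _ (isPC_seg hx)).1
  simp only [lyap]
  linarith

/-- A bound on `e^{μ t} V` over `[t₀, T)` passes to the value after the jump at `T`. -/
theorem lyap_jump_le (h : LyapunovPair hr f V₁ V₂ α₁ α₂ α₃ χ μ)
    {I : ℕ → ℝ → Hist r n → Euc m → Euc n} {ρ c : ℝ} (hI : JumpBound hr I V₁ V₂ χ ρ c)
    (hρ : 0 ≤ ρ) (hc : 0 ≤ c) {x : ℝ → Euc n} {t₀ a T B : ℝ} {k : ℕ} {y : Euc m} {φ : Hist r n}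
    (ht₀ : 0 ≤ t₀) (ha : t₀ ≤ a) (haT : a < T) (hk : 1 ≤ k) (hx : PCOn x (Icc (t₀ - r) T))
    (hφ : IsPC φ) (hxφ : seg r x t₀ = φ) (hxc : ContinuousOn x (Ico a T))
    (hxT : x T = Function.leftLim x T + I k T (segLeft r x T) y)
    (hB : ∀ t ∈ Ico t₀ T, Real.exp (μ * (t - t₀)) * lyap V₁ V₂ x t ≤ B)
    (hB0 : α₂ (normR φ) ≤ B) :
    Real.exp (μ * (T - t₀)) * lyap V₁ V₂ x T ≤
      (ρ + c * Real.exp (μ * r)) * B + Real.exp (μ * (T - t₀)) * χ ‖y‖ := by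
  have hμ := h.rate_pos
  have hT0 : 0 ≤ T := by linarith
  set ξ := Function.leftLim x T
  have hlim : Tendsto x (𝓝[<] T) (𝓝 ξ) :=
    hx.tendsto_leftLim ⟨by linarith, le_rfl⟩ haT fun s hs => ⟨by linarith [hs.1], hs.2.le⟩
  -- `z` is `x` with the jump at `T` undone: it is continuous on `[a, T]` and its segment at `T` is
  -- the pre-jump segment.
  set z : ℝ → Euc n := fun t => if t < T then x t else ξ with hz
  have hzT : z T = ξ := if_neg (lt_irrefl T)
  have hzx : ∀ t < T, z t = x t := fun t ht => if_pos ht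
  have hzpc : PCOn z (Icc (t₀ - r) T) :=
    PCOn.glue ⟨by linarith, le_rfl⟩ (hx.mono inter_subset_left)
      (PCOn.of_continuousOn (J := Ici T) continuousOn_const |>.mono inter_subset_right)
  have hzc : ContinuousOn z (Icc a T) := by
    intro t ht
    rcases ht.2.lt_or_eq with h' | rfl
    · have h1 : ContinuousWithinAt x (Icc a T) t := by
        refine (hxc t ⟨ht.1, h'⟩).mono_of_mem_nhdsWithin ?_
        filter_upwards [self_mem_nhdsWithin, mem_nhdsWithin_of_mem_nhds (Iio_mem_nhds h')]
          with s hs hs' using ⟨hs.1, hs'⟩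
      refine h1.congr_of_eventuallyEq ?_ (hzx t h')
      filter_upwards [mem_nhdsWithin_of_mem_nhds (Iio_mem_nhds h')] with s hs using hzx s hs
    · have h1 : ContinuousWithinAt z (Iio t) t := by
        rw [ContinuousWithinAt, hzT]
        refine hlim.congr' ?_
        filter_upwards [self_mem_nhdsWithin] with s hs using (hzx s hs).symm
      exact (continuousWithinAt_insert_self.2 h1).mono fun s hs =>
        hs.2.lt_or_eq.elim (fun h => Or.inr h) (fun h => Or.inl h)
  have hzseg : seg r z T = segLeft r x T := by
    funext s
    simp only [seg, segLeft]
    rcases s.2.2.lt_or_eq with hs | hs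
    · rw [if_pos hs, hzx _ (by linarith)]
    · rw [hs, if_neg (lt_irrefl 0), add_zero, hzT]
  have hsubT : Icc (a - r) T ⊆ Icc (t₀ - r) T := Icc_subset_Icc_left (by linarith)
  have hcont := h.continuousOn_lyap (ht₀.trans ha) haT.le (hzpc.mono hsubT) hzc
  have hIco : ∀ᶠ t in 𝓝[<] T, t ∈ Ico a T := Ico_mem_nhdsLT haT
  -- `V₂` is continuous along both `x` and `z`, which agree before `T`; so its values at `T` are the
  -- same limit.
  have hV₂ : V₂ T (seg r x T) = V₂ T (segLeft r x T) := by
    have h1 : Tendsto (fun t => V₂ t (seg r x t)) (𝓝[<] T) (𝓝 (V₂ T (seg r x T))) := by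
      rw [← nhdsWithin_Ico_eq_nhdsLT haT]
      exact ((h.continuousOn_nuStar (ht₀.trans ha) haT.le (hx.mono hsubT)) T
        (right_mem_Icc.2 haT.le)).mono Ico_subset_Icc_self
    have h2 : Tendsto (fun t => V₂ t (seg r z t)) (𝓝[<] T) (𝓝 (V₂ T (seg r z T))) := by
      rw [← nhdsWithin_Ico_eq_nhdsLT haT]
      exact ((h.continuousOn_nuStar (ht₀.trans ha) haT.le (hzpc.mono hsubT)) T
        (right_mem_Icc.2 haT.le)).mono Ico_subset_Icc_self
    rw [← hzseg]
    refine tendsto_nhds_unique h1 (h2.congr' ?_)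
    filter_upwards [hIco] with t ht
    rw [seg_congr (y := x)]
    exact fun s hs => hzx s (hs.2.trans_lt ht.2)
  have hzlyap : ∀ t < T, lyap V₁ V₂ z t = lyap V₁ V₂ x t := fun t ht => by
    simp only [lyap]
    rw [hzx t ht, seg_congr (y := x)]
    exact fun s hs => hzx s (hs.2.trans_lt ht)
  have hzB : Real.exp (μ * (T - t₀)) * lyap V₁ V₂ z T ≤ B := by
    have h1 : ContinuousOn (fun t => Real.exp (μ * (t - t₀)) * lyap V₁ V₂ z t) (Icc a T) :=
      ContinuousOn.mul (by fun_prop) hcont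
    have h2 : Tendsto (fun t => Real.exp (μ * (t - t₀)) * lyap V₁ V₂ z t) (𝓝[<] T)
        (𝓝 (Real.exp (μ * (T - t₀)) * lyap V₁ V₂ z T)) := by
      rw [← nhdsWithin_Ico_eq_nhdsLT haT]
      exact (h1 T (right_mem_Icc.2 haT.le)).mono Ico_subset_Icc_self
    refine le_of_tendsto h2 ?_
    filter_upwards [hIco] with t ht
    rw [hzlyap t ht.2]
    exact hB t ⟨ha.trans ht.1, ht.2⟩
  have hBnn : 0 ≤ B := le_trans (h.kinf₂.toClassK.nonneg (Real.iSup_nonneg fun _ => norm_nonneg _)) hB0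
  -- Moving the weight from `T + s` to `T` costs `e^{-μs} ≤ e^{μr}`. Where the window reaches back
  -- before `t₀`, one has `T - t₀ ≤ r`, and `V₁` is bounded through `α₂ (normR φ)`.
  have hsup : Real.exp (μ * (T - t₀)) * (⨆ s : Icc (-r) (0 : ℝ), V₁ (T + s) (segLeft r x T s)) ≤
      Real.exp (μ * r) * B := by
    have : Nonempty (Icc (-r) (0 : ℝ)) := ⟨windowEnd hr⟩
    rw [← le_div_iff₀' (Real.exp_pos _)]
    refine ciSup_le fun s => ?_
    rw [le_div_iff₀' (Real.exp_pos _), ← hzseg]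
    have hsr := s.2.1
    have hs0 := s.2.2
    simp only [seg]
    rcases lt_or_ge (T + s) t₀ with hlt | hge
    · have h1 : V₁ (T + s) (z (T + s)) ≤ B := by
        rw [hzx _ (by linarith)]
        refine (h.bounds₁ _ (by linarith) _).2.trans
          ((h.kinf₂.toClassK.mono (norm_nonneg _) ?_).trans hB0)
        have := hφ.norm_le_normR ⟨T + s - t₀, by linarith, by linarith⟩
        rw [← hxφ] at this
        simpa [seg, hxφ] using this
      exact mul_le_mul (Real.exp_le_exp.2 (by nlinarith)) h1
        ((h.kinf₁.toClassK.nonneg (norm_nonneg _)).trans (h.bounds₁ _ (by linarith) _).1)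
        (Real.exp_pos _).le
    · have h1 : Real.exp (μ * (T + s - t₀)) * V₁ (T + s) (z (T + s)) ≤ B := by
        have hle : V₁ (T + s) (z (T + s)) ≤ lyap V₁ V₂ z (T + s) :=
          h.le_lyap (by linarith) (hzpc.mono (Icc_subset_Icc (by linarith) (by linarith)))
        refine (mul_le_mul_of_nonneg_left hle (Real.exp_pos _).le).trans ?_
        rcases hs0.lt_or_eq with hs | hs
        · rw [hzlyap _ (by linarith)]
          exact hB _ ⟨hge, by linarith⟩
        · rw [hs, add_zero]
          exact hzB
      have h2 : Real.exp (μ * (T - t₀)) = Real.exp (μ * (-s)) * Real.exp (μ * (T + s - t₀)) := by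
        rw [← Real.exp_add]
        ring_nf
      rw [h2, mul_assoc]
      exact (mul_le_mul_of_nonneg_left h1 (Real.exp_pos _).le).trans
        (mul_le_mul_of_nonneg_right (Real.exp_le_exp.2 (by nlinarith)) hBnn)
  have hjump := hI k hk T hT0 (segLeft r x T)
    (hzseg ▸ isPC_seg (hzpc.mono (Icc_subset_Icc_left (by linarith)))) y
  have hend : segLeft r x T (windowEnd hr) = ξ := by simp [segLeft, windowEnd, ξ]
  rw [hend, ← hxT, ← hV₂] at hjump
  have hzl : lyap V₁ V₂ z T = V₁ T ξ + V₂ T (seg r x T) := by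
    rw [lyap, hzT, hzseg, hV₂]
  rw [← hzl] at hjump
  have hl : lyap V₁ V₂ x T = V₁ T (x T) + V₂ T (seg r x T) := rfl
  rw [← hl] at hjump
  have he := (Real.exp_pos (μ * (T - t₀))).le
  have h1 := mul_le_mul_of_nonneg_left hjump he
  have h2 := mul_le_mul_of_nonneg_left hzB hρ
  have h3 := mul_le_mul_of_nonneg_left hsup hc
  linarith

/-- The envelope of `e^{μ (t - t₀)} V` after the impulses: the contribution `a₀` of the initial
history decays at the rate `μ - ν`, that of the inputs, `X`, is not amplified. -/
noncomputable def envelope (μ ν q a₀ s X : ℝ) : ℝ :=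
  Real.exp (ν * s) * a₀ + q * Real.exp (μ * s) * X

theorem le_envelope {μ ν q a₀ s X : ℝ} (ha₀ : 0 ≤ a₀) (hX : 0 ≤ X) (hq : 0 ≤ q) (hν : 0 ≤ ν)
    (hs : 0 ≤ s) : a₀ ≤ envelope μ ν q a₀ s X := by
  have h1 : a₀ ≤ Real.exp (ν * s) * a₀ :=
    le_mul_of_one_le_left ha₀ (Real.one_le_exp (mul_nonneg hν hs))
  have h2 : 0 ≤ q * Real.exp (μ * s) * X := by positivity
  simp only [envelope]
  linarith

/-- The factor `q` of a jump is absorbed by the growth of the two exponentials from `s` to `s'`.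
Only the input `Y` of the latest interval keeps it, which is why the envelope carries one `q` in
front of the inputs. -/
theorem envelope_step {μ ν q a₀ s s' X Y c : ℝ} (ha₀ : 0 ≤ a₀) (hX : 0 ≤ X)
    (hc : 0 ≤ c) (hq : 1 ≤ q) (hν : q * Real.exp (ν * s) ≤ Real.exp (ν * s'))
    (hμ : q * Real.exp (μ * s) ≤ Real.exp (μ * s')) :
    q * (envelope μ ν q a₀ s X + Real.exp (μ * s') * Y) + Real.exp (μ * s') * c ≤
      envelope μ ν q a₀ s' (X + Y + c) := by
  have h1 := mul_le_mul_of_nonneg_right hν ha₀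
  have h2 := mul_le_mul_of_nonneg_right hμ (mul_nonneg (zero_le_one.trans hq) hX)
  have h3 : Real.exp (μ * s') * c ≤ q * (Real.exp (μ * s') * c) :=
    le_mul_of_one_le_left (by positivity) hq
  simp only [envelope]
  linarith

end LyapunovPair

namespace LyapunovPair

variable {r : ℝ} {hr : 0 < r} {n m : ℕ} {f : ℝ → Hist r n → Euc m → Euc n}
    {V₁ : ℝ → Euc n → ℝ} {V₂ : ℝ → Hist r n → ℝ} {α₁ α₂ α₃ χ : ℝ → ℝ} {μ : ℝ}

/-! ### The decay estimate along a solution. -/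

section Estimate

variable {I : ℕ → ℝ → Hist r n → Euc m → Euc n} {ρ c q ν δ : ℝ} {t₀ : ℝ} {τ : ℕ → ℝ}
  {w : ℝ → Euc m} {φ : Hist r n} {x : ℝ → Euc n}

theorem pcOn_solution (hx : IsSolutionOn f I τ w t₀ φ (Ici t₀) x) {s t : ℝ} (hs : t₀ - r ≤ s) :
    PCOn x (Icc s t) :=
  hx.pc.mono fun u hu => (le_total u t₀).elim (fun h => Or.inl ⟨hs.trans hu.1, h⟩) Or.inr

/-- Between impulses, a bound on `e^{μ t} V` grows only through the input. -/
theorem exp_mul_lyap_le (h : LyapunovPair hr f V₁ V₂ α₁ α₂ α₃ χ μ) (ht₀ : 0 ≤ t₀) (h0 : τ 0 = t₀)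
    (hτ : StrictMono τ) (hw : PCOn w (Ici t₀)) (hx : IsSolutionOn f I τ w t₀ φ (Ici t₀) x)
    {A : ℝ} {k : ℕ} (hA : Real.exp (μ * (τ k - t₀)) * lyap V₁ V₂ x (τ k) ≤
      Real.exp (∫ s in t₀..τ k, χ ‖w s‖) * A) {t : ℝ} (ht : t ∈ Ico (τ k) (τ (k + 1))) :
    Real.exp (μ * (t - t₀)) * lyap V₁ V₂ x t ≤ Real.exp (∫ s in t₀..t, χ ‖w s‖) *
      (A + Real.exp (μ * (t - t₀)) * ∫ s in τ k..t, χ ‖w s‖) := by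
  have hge : t₀ ≤ τ k := h0 ▸ hτ.monotone (Nat.zero_le k)
  have hχw := h.pcOn_gain hw
  have hadd := intervalIntegral.integral_add_adjacent_intervals
    (hχw.intervalIntegrable_Ici le_rfl hge) (hχw.intervalIntegrable_Ici hge (hge.trans ht.1))
  have hpc : IsPC (seg r x (τ k)) := isPC_seg (pcOn_solution hx (by linarith))
  have hl := h.lyap_le (ht₀.trans hge) hpc (hw.mono (Ici_subset_Ici.2 hge))
    (hx.isFlowOn h0 hτ le_rfl fun s hs => mem_Ici.2 (hge.trans hs.1)) ht
  set X := ∫ s in t₀..τ k, χ ‖w s‖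
  set Y := ∫ s in τ k..t, χ ‖w s‖
  have hX : 0 ≤ X := intervalIntegral.integral_nonneg hge fun s _ => h.gain_nonneg _
  have hY : 0 ≤ Y := intervalIntegral.integral_nonneg ht.1 fun s _ => h.gain_nonneg _
  rw [← hadd]
  have e1 : Real.exp (μ * (t - t₀)) * Real.exp (-μ * (t - τ k)) = Real.exp (μ * (τ k - t₀)) := by
    rw [← Real.exp_add]; ring_nf
  have e2 : Real.exp (μ * (τ k - t₀)) * Real.exp (μ * (t - τ k)) = Real.exp (μ * (t - t₀)) := by
    rw [← Real.exp_add]; ring_nf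
  calc _ ≤ Real.exp (μ * (t - t₀)) * (Real.exp (-μ * (t - τ k)) * Real.exp Y *
        (lyap V₁ V₂ x (τ k) + Real.exp (μ * (t - τ k)) * Y)) :=
      mul_le_mul_of_nonneg_left hl (Real.exp_pos _).le
    _ = Real.exp Y * ((Real.exp (μ * (t - t₀)) * Real.exp (-μ * (t - τ k))) * lyap V₁ V₂ x (τ k) +
        ((Real.exp (μ * (t - t₀)) * Real.exp (-μ * (t - τ k))) * Real.exp (μ * (t - τ k))) * Y) := by
      ring
    _ ≤ Real.exp Y * (Real.exp X * A + Real.exp X * (Real.exp (μ * (t - t₀)) * Y)) := by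
      rw [e1, e2]
      refine mul_le_mul_of_nonneg_left (add_le_add hA ?_) (Real.exp_pos _).le
      exact le_mul_of_one_le_left (by positivity) (Real.one_le_exp hX)
    _ = _ := by rw [Real.exp_add]; ring

/-- The induction bounds the whole past up to `τ k` by the envelope at `τ k`, since a jump sees a
delay window that may contain several earlier impulses. -/
theorem exp_mul_lyap_le_envelope (h : LyapunovPair hr f V₁ V₂ α₁ α₂ α₃ χ μ)
    (hI : JumpBound hr I V₁ V₂ χ ρ c) (hρ : 0 ≤ ρ) (hc : 0 ≤ c) (hq : q = ρ + c * Real.exp (μ * r))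
    (hqν : q = Real.exp (ν * δ)) (hν : 0 ≤ ν) (hνμ : ν ≤ μ) (hδ : 0 ≤ δ)
    (ht₀ : 0 ≤ t₀) (hτ : τ ∈ dwellClass δ t₀) (hφ : IsPC φ) (hw : PCOn w (Ici t₀))
    (hx : IsSolutionOn f I τ w t₀ φ (Ici t₀) x) (k : ℕ) :
    ∀ t ∈ Icc t₀ (τ k), Real.exp (μ * (t - t₀)) * lyap V₁ V₂ x t ≤
      Real.exp (∫ s in t₀..τ k, χ ‖w s‖) *
        envelope μ ν q (α₂ (normR φ) + α₃ (normR φ)) (τ k - t₀) ((∫ s in t₀..τ k, χ ‖w s‖) +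
          ∑ j ∈ Finset.Icc 1 k, χ ‖Function.leftLim w (τ j)‖) := by
  obtain ⟨h0, hmono, -, hdw⟩ := hτ
  have hge : ∀ k, t₀ ≤ τ k := fun k => h0 ▸ hmono.monotone (Nat.zero_le k)
  have hχw := h.pcOn_gain hw
  have hN0 : 0 ≤ normR φ := Real.iSup_nonneg fun σ => norm_nonneg _
  have hα₂0 := h.kinf₂.toClassK.nonneg hN0
  have hα₃0 := h.kinf₃.toClassK.nonneg hN0
  have hq1 : 1 ≤ q := hqν ▸ Real.one_le_exp (mul_nonneg hν hδ)
  induction k with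
  | zero =>
    intro t ht
    rw [h0] at ht
    obtain rfl : t = t₀ := le_antisymm ht.2 ht.1
    have h1 : lyap V₁ V₂ x t ≤ α₂ (normR φ) + α₃ (normR φ) := by
      simp only [lyap, hx.init]
      refine add_le_add ((h.bounds₁ t (by linarith) _).2.trans
        (h.kinf₂.toClassK.mono (norm_nonneg _) ?_)) (h.bounds₂ t ht₀ φ hφ).2
      have := hφ.norm_le_normR (windowEnd hr)
      rw [← hx.init] at this
      simpa [seg, windowEnd, hx.init] using this
    simpa [h0, envelope] using h1
  | succ k ih =>
    set a := τ k with ha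
    set b := τ (k + 1) with hb
    have hab : a < b := hmono (Nat.lt_succ_self k)
    have hadd := intervalIntegral.integral_add_adjacent_intervals
      (hχw.intervalIntegrable_Ici le_rfl (hge k))
      (hχw.intervalIntegrable_Ici (hge k) (hge (k + 1)))
    set X := ∫ s in t₀..a, χ ‖w s‖
    set S := ∑ j ∈ Finset.Icc 1 k, χ ‖Function.leftLim w (τ j)‖ with hS
    have hX : 0 ≤ X := intervalIntegral.integral_nonneg (hge k) fun s _ => h.gain_nonneg _
    have hS0 : 0 ≤ S := Finset.sum_nonneg fun j _ => h.gain_nonneg _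
    set Y := ∫ s in a..b, χ ‖w s‖
    have hY : 0 ≤ Y := intervalIntegral.integral_nonneg hab.le fun s _ => h.gain_nonneg _
    set a₀ := α₂ (normR φ) + α₃ (normR φ)
    set A := envelope μ ν q a₀ (a - t₀) (X + S) with hA
    set g := χ ‖Function.leftLim w b‖ with hg
    have hg0 : 0 ≤ g := h.gain_nonneg _
    have hδab : δ ≤ b - a := hdw k
    -- The dwell time enters here: `νδ ≤ ηδ ≤ η (b - a)`. It is used for `η = ν` and `η = μ`.
    have hqexp : ∀ η, ν ≤ η → 0 ≤ η →
        q * Real.exp (η * (a - t₀)) ≤ Real.exp (η * (b - t₀)) := fun η hη hη0 => by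
      rw [hqν, ← Real.exp_add]
      refine Real.exp_le_exp.2 ?_
      have h1 := mul_le_mul_of_nonneg_left hδab hη0
      have h2 := mul_le_mul_of_nonneg_right hη hδ
      linarith
    have ha₀ : 0 ≤ a₀ := add_nonneg hα₂0 hα₃0
    have hstep := envelope_step (X := X + S) (Y := Y) (c := g) ha₀ (add_nonneg hX hS0) hg0 hq1
      (hqexp ν le_rfl hν) (hqexp μ hνμ h.rate_pos.le)
    have hA0 : a₀ ≤ A := le_envelope ha₀ (add_nonneg hX hS0) (zero_le_one.trans hq1) hν
      (sub_nonneg.2 (hge k))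
    set G := A + Real.exp (μ * (b - t₀)) * Y with hG
    have hGA : A ≤ G := le_add_of_nonneg_right (mul_nonneg (Real.exp_pos _).le hY)
    have hA00 : 0 ≤ A := ha₀.trans hA0
    have hGqG : G ≤ q * G := le_mul_of_one_le_left (hA00.trans hGA) hq1
    have hbefore : ∀ t ∈ Ico t₀ b, Real.exp (μ * (t - t₀)) * lyap V₁ V₂ x t ≤
        Real.exp (X + Y) * G := by
      intro t ht
      rcases le_or_gt t a with hta | hta
      · refine (ih t ⟨ht.1, hta⟩).trans ?_
        exact mul_le_mul (Real.exp_le_exp.2 (by linarith)) hGA hA00 (Real.exp_pos _).le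
      · refine (h.exp_mul_lyap_le ht₀ h0 hmono hw hx (ih a ⟨hge k, le_rfl⟩) ⟨hta.le, ht.2⟩).trans ?_
        have i1 := intervalIntegral.integral_add_adjacent_intervals
          (hχw.intervalIntegrable_Ici (hge k) ht.1)
          (hχw.intervalIntegrable_Ici ht.1 (hge (k + 1)))
        have i2 := intervalIntegral.integral_add_adjacent_intervals
          (hχw.intervalIntegrable_Ici le_rfl (hge k)) (hχw.intervalIntegrable_Ici (hge k) ht.1)
        have i3 : 0 ≤ ∫ s in t..b, χ ‖w s‖ :=
          intervalIntegral.integral_nonneg ht.2.le fun s _ => h.gain_nonneg _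
        have i4 : 0 ≤ ∫ s in a..t, χ ‖w s‖ :=
          intervalIntegral.integral_nonneg hta.le fun s _ => h.gain_nonneg _
        have i5 : (∫ s in a..t, χ ‖w s‖) ≤ Y := by linarith
        have i6 : (∫ s in t₀..t, χ ‖w s‖) ≤ X + Y := by linarith
        have hμ := h.rate_pos
        have hG' : A + Real.exp (μ * (t - t₀)) * (∫ s in a..t, χ ‖w s‖) ≤ G := by
          refine add_le_add le_rfl (mul_le_mul (Real.exp_le_exp.2 ?_) i5 i4 (Real.exp_pos _).le)
          exact mul_le_mul_of_nonneg_left (by linarith [ht.2]) hμ.le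
        exact mul_le_mul (Real.exp_le_exp.2 i6) hG'
          (add_nonneg hA00 (mul_nonneg (Real.exp_pos _).le i4)) (Real.exp_pos _).le
    have hsum : ∑ j ∈ Finset.Icc 1 (k + 1), χ ‖Function.leftLim w (τ j)‖ = S + g := by
      rw [Finset.sum_Icc_succ_top (by omega)]
    rw [← hadd, hsum, show X + Y + (S + g) = X + S + Y + g by ring]
    have hexp1 : 1 ≤ Real.exp (X + Y) := Real.one_le_exp (add_nonneg hX hY)
    have hfin : Real.exp (X + Y) * (q * G + Real.exp (μ * (b - t₀)) * g) ≤
        Real.exp (X + Y) * envelope μ ν q a₀ (b - t₀) (X + S + Y + g) :=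
      mul_le_mul_of_nonneg_left hstep (Real.exp_pos _).le
    have hg1 : 0 ≤ Real.exp (μ * (b - t₀)) * g := mul_nonneg (Real.exp_pos _).le hg0
    intro t ht
    rcases ht.2.lt_or_eq with hlt | rfl
    · refine (hbefore t ⟨ht.1, hlt⟩).trans (le_trans ?_ hfin)
      exact mul_le_mul_of_nonneg_left (by linarith) (Real.exp_pos _).le
    · have hj := h.lyap_jump_le hI hρ hc ht₀ (hge k) hab (by omega)
        (pcOn_solution hx le_rfl) hφ hx.init
        (hx.isFlowOn h0 hmono le_rfl fun s hs => mem_Ici.2 ((hge k).trans hs.1)).cont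
        (hx.jump (k + 1) (by omega) (hge (k + 1))) hbefore (by
          have : a₀ ≤ Real.exp (X + Y) * G :=
            (hA0.trans hGA).trans (le_mul_of_one_le_left (hA00.trans hGA) hexp1)
          exact le_trans (le_add_of_nonneg_right hα₃0) this)
      rw [← hq] at hj
      refine hj.trans (le_trans ?_ hfin)
      have : Real.exp (μ * (τ (k + 1) - t₀)) * g ≤
          Real.exp (X + Y) * (Real.exp (μ * (τ (k + 1) - t₀)) * g) :=
        le_mul_of_one_le_left hg1 hexp1
      linarith

theorem log_one_add_le (h : LyapunovPair hr f V₁ V₂ α₁ α₂ α₃ χ μ)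
    (hI : JumpBound hr I V₁ V₂ χ ρ c) (hρ : 0 ≤ ρ) (hc : 0 ≤ c) (hq : q = ρ + c * Real.exp (μ * r))
    (hqν : q = Real.exp (ν * δ)) (hν : 0 ≤ ν) (hνμ : ν ≤ μ) (hδ : 0 ≤ δ)
    (ht₀ : 0 ≤ t₀) (hτ : τ ∈ dwellClass δ t₀) (hφ : IsPC φ) (hw : PCOn w (Ici t₀))
    (hx : IsSolutionOn f I τ w t₀ φ (Ici t₀) x) {t : ℝ} (ht : t₀ ≤ t) :
    Real.log (1 + α₁ ‖x t‖) ≤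
      Real.exp (-(μ - ν) * (t - t₀)) * (α₂ (normR φ) + α₃ (normR φ)) +
      (∫ s in t₀..t, (1 + q) * χ ‖w s‖) +
        ∑ᶠ k ∈ {k : ℕ | t₀ < τ k ∧ τ k ≤ t}, (1 + q) * χ ‖Function.leftLim w (τ k)‖ := by
  have henv := fun k => h.exp_mul_lyap_le_envelope hI hρ hc hq hqν hν hνμ hδ ht₀ hτ hφ hw hx k
  obtain ⟨h0, hmono, htop, hdw⟩ := hτ
  have hge : ∀ k, t₀ ≤ τ k := fun k => h0 ▸ hmono.monotone (Nat.zero_le k)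
  obtain ⟨k, hk⟩ := exists_mem_Ico_impulses htop (h0.symm ▸ ht)
  have hfs := finsum_mem_impulses hmono hk fun k => (1 + q) * χ ‖Function.leftLim w (τ k)‖
  rw [h0] at hfs
  rw [hfs, ← Finset.mul_sum, intervalIntegral.integral_const_mul]
  have hχw := h.pcOn_gain hw
  have hN0 : 0 ≤ normR φ := Real.iSup_nonneg fun σ => norm_nonneg _
  have hα₂0 := h.kinf₂.toClassK.nonneg hN0
  have hα₃0 := h.kinf₃.toClassK.nonneg hN0
  have hq1 : 1 ≤ q := hqν ▸ Real.one_le_exp (mul_nonneg hν hδ)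
  have hadd := intervalIntegral.integral_add_adjacent_intervals
    (hχw.intervalIntegrable_Ici le_rfl (hge k)) (hχw.intervalIntegrable_Ici (hge k) ht)
  have hl := h.exp_mul_lyap_le ht₀ h0 hmono hw hx (henv k _ ⟨hge k, le_rfl⟩) hk
  set S := ∑ j ∈ Finset.Icc 1 k, χ ‖Function.leftLim w (τ j)‖
  set X := ∫ s in t₀..t, χ ‖w s‖
  set X' := ∫ s in t₀..τ k, χ ‖w s‖
  set Y := ∫ s in τ k..t, χ ‖w s‖
  set a₀ := α₂ (normR φ) + α₃ (normR φ)
  have ha₀ : 0 ≤ a₀ := by positivity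
  have hX' : 0 ≤ X' := intervalIntegral.integral_nonneg (hge k) fun s _ => h.gain_nonneg _
  have hY : 0 ≤ Y := intervalIntegral.integral_nonneg hk.1 fun s _ => h.gain_nonneg _
  have hS0 : 0 ≤ S := Finset.sum_nonneg fun j _ => h.gain_nonneg _
  have hq0 : 0 ≤ q := zero_le_one.trans hq1
  have hμ := h.rate_pos
  -- Dividing the envelope bound by `e^{μ(t - t₀)}` leaves decay at the rate `μ - ν` on the history
  -- term and no growth on the input terms.
  have hV : lyap V₁ V₂ x t ≤
      Real.exp X * (Real.exp (-(μ - ν) * (t - t₀)) * a₀ + q * (X + S)) := by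
    refine le_of_mul_le_mul_left (hl.trans ?_) (Real.exp_pos (μ * (t - t₀)))
    have e1 : Real.exp (μ * (t - t₀)) * Real.exp (-(μ - ν) * (t - t₀)) =
        Real.exp (ν * (t - t₀)) := by
      rw [← Real.exp_add]; ring_nf
    have e2 : Real.exp (ν * (τ k - t₀)) ≤ Real.exp (ν * (t - t₀)) :=
      Real.exp_le_exp.2 (mul_le_mul_of_nonneg_left (by linarith [hk.1]) hν)
    have e3 : Real.exp (μ * (τ k - t₀)) ≤ Real.exp (μ * (t - t₀)) :=
      Real.exp_le_exp.2 (mul_le_mul_of_nonneg_left (by linarith [hk.1]) hμ.le)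
    have e4 : Real.exp (μ * (t - t₀)) * Y ≤ q * (Real.exp (μ * (t - t₀)) * Y) :=
      le_mul_of_one_le_left (by positivity) hq1
    calc _ ≤ Real.exp X * (Real.exp (ν * (t - t₀)) * a₀ +
          q * Real.exp (μ * (t - t₀)) * (X' + S) + q * (Real.exp (μ * (t - t₀)) * Y)) := by
          refine mul_le_mul_of_nonneg_left (add_le_add ?_ e4) (Real.exp_pos _).le
          unfold envelope
          gcongr
      _ = _ := by
        rw [← e1, ← hadd]
        ring
  have hle : α₁ ‖x t‖ ≤ lyap V₁ V₂ x t :=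
    (h.bounds₁ t (by linarith) _).1.trans
      (h.le_lyap (ht₀.trans ht) (pcOn_solution hx (by linarith)))
  -- The exponent contributes one `X` and the bracket `q (X + S)`, whence the gain `(1 + q) χ`.
  have hlog := log_one_add_le_of_le_exp_mul (h.kinf₁.toClassK.nonneg (norm_nonneg _))
    (by linarith : 0 ≤ X) (add_nonneg (by positivity) (mul_nonneg hq0 (by linarith)))
    (hle.trans hV)
  linarith

end Estimate

/-! ### Conclusion. -/

theorem uniformlyIISS (h : LyapunovPair hr f V₁ V₂ α₁ α₂ α₃ χ μ) (hf : RegularRHS f)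
    {I : ℕ → ℝ → Hist r n → Euc m → Euc n} {ρ c δ : ℝ} (hI : JumpBound hr I V₁ V₂ χ ρ c)
    (hρ : 0 ≤ ρ) (hc : 0 ≤ c) (hq1 : 1 ≤ ρ + c * Real.exp (μ * r))
    (hq : Real.log (ρ + c * Real.exp (μ * r)) < μ * δ) : UniformlyIISS f I (dwellClass δ) := by
  set q := ρ + c * Real.exp (μ * r) with hqdef
  have hμ := h.rate_pos
  have hlog := Real.log_nonneg hq1
  -- As `q ≥ 1`, the dwell-time condition itself forces `δ > 0`, so `ν = log q / δ` makes sense.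
  have hδ : 0 < δ := pos_of_mul_pos_right (hlog.trans_lt hq) hμ.le
  have hν : 0 ≤ Real.log q / δ := div_nonneg hlog hδ.le
  have hνμ : Real.log q / δ < μ := (div_lt_iff₀ hδ).2 hq
  have hqν : q = Real.exp (Real.log q / δ * δ) := by
    rw [div_mul_cancel₀ _ hδ.ne', Real.exp_log (by linarith)]
  refine ⟨fun s t => Real.exp (-(μ - Real.log q / δ) * t) * (α₂ s + α₃ s),
    fun s => Real.log (1 + α₁ s), fun s => (1 + q) * χ s,
    (h.kinf₂.toClassK.add h.kinf₃.toClassK).classKL_exp_mul (sub_pos.2 hνμ),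
    h.kinf₁.log_one_add, h.kinf_gain.const_mul (by linarith),
    fun t₀ ht₀ τ hτ φ hφ w hw => ?_⟩
  obtain ⟨x, hx⟩ := h.exists_solution hf I ht₀ hτ.1 hτ.2.1 hτ.2.2.1 hφ hw
  exact ⟨x, hx, fun b y hy => (hx.mono Ico_subset_Ici_self).eqOn hr hf ht₀ hτ.1 hτ.2.1 hτ.2.2.1 hw hy,
    fun t ht => h.log_one_add_le hI hρ hc hqdef hqν hν hνμ.le hδ.le ht₀ hτ hφ hw hx ht⟩

end LyapunovPair

theorem theorem1 (n m : ℕ) (r : ℝ) (hr : 0 < r)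
    (f : ℝ → Hist r n → Euc m → Euc n) (I : ℕ → ℝ → Hist r n → Euc m → Euc n)
    (hf : RegularRHS f)
    (hf0 : ∀ t, 0 ≤ t → f t 0 0 = 0)
    (hI0 : ∀ k, 1 ≤ k → ∀ t, 0 ≤ t → I k t 0 0 = 0)
    (V₁ : ℝ → Euc n → ℝ) (V₂ : ℝ → Hist r n → ℝ) (hV₁ : ClassNu V₁) (hV₂ : ClassNuStar V₂)
    (α₁ α₂ α₃ χ : ℝ → ℝ)
    (hα₁ : ClassKInf α₁) (hα₂ : ClassKInf α₂) (hα₃ : ClassKInf α₃) (hχ : ClassKInf χ)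
    (μ ρ₁ ρ₂ δ : ℝ) (hμ : 0 < μ) (hρ₁ : 0 ≤ ρ₁) (hρ₂ : 0 ≤ ρ₂)
    -- (i); `V₁` is also evaluated at the times `t + s ∈ [-r, 0)` in (iii) and (b)
    (hi₁ : ∀ t, -r ≤ t → ∀ x, α₁ ‖x‖ ≤ V₁ t x ∧ V₁ t x ≤ α₂ ‖x‖)
    (hi₂ : ∀ t, 0 ≤ t → ∀ φ : Hist r n, IsPC φ → 0 ≤ V₂ t φ ∧ V₂ t φ ≤ α₃ (normR φ))
    -- (ii)
    (hii : ∀ t, 0 ≤ t → ∀ φ : Hist r n, IsPC φ → ∀ w : ℝ → Euc m, PCOn w (Ici t) →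
      ∀ b, t < b → ∀ x : ℝ → Euc n, IsFlowOn f w t φ b x →
      upperDini (fun u ψ => V₁ u (ψ (windowEnd hr)) + V₂ u ψ) x t ≤
        (((χ ‖w t‖ - μ) * (V₁ t (φ (windowEnd hr)) + V₂ t φ) + χ ‖w t‖ : ℝ) : EReal))
    -- (iii)
    (hiii : ∀ k, 1 ≤ k → ∀ t, 0 ≤ t → ∀ φ : Hist r n, IsPC φ → ∀ y : Euc m,
      V₁ t (φ (windowEnd hr) + I k t φ y) ≤
        ρ₁ * V₁ t (φ (windowEnd hr)) +
          ρ₂ * (⨆ s : Icc (-r) (0 : ℝ), V₁ (t + s) (φ s)) + χ ‖y‖)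
    -- (a) or (b)
    (hab : (1 ≤ ρ₁ ∧ Real.log (ρ₁ + ρ₂ * Real.exp (μ * r)) < μ * δ) ∨
      (ρ₁ < 1 ∧ 1 ≤ ρ₁ + ρ₂ ∧ ∃ κ : ℝ, 0 < κ ∧
        (∀ t, 0 ≤ t → ∀ φ : Hist r n, IsPC φ →
          V₂ t φ ≤ κ * ⨆ s : Icc (-r) (0 : ℝ), V₁ (t + s) (φ s)) ∧
        Real.log (ρ₁ + (ρ₂ + (1 - ρ₁) * κ) * Real.exp (μ * r)) < μ * δ)) :
    UniformlyIISS f I (dwellClass δ) := by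
  have h : LyapunovPair hr f V₁ V₂ α₁ α₂ α₃ χ μ :=
    ⟨hV₁, hV₂, hα₁, hα₂, hα₃, hχ, hμ, hi₁, hi₂, hii⟩
  have hexp : 1 ≤ Real.exp (μ * r) := Real.one_le_exp (by positivity)
  rcases hab with ⟨h1, hlog⟩ | ⟨h1, h12, κ, hκ, hVκ, hlog⟩
  -- As `ρ₁ ≥ 1`, the unchanged term satisfies `V₂ ≤ ρ₁ V₂`.
  · refine h.uniformlyIISS hf (ρ := ρ₁) (c := ρ₂) (fun k hk t ht φ hφ y => ?_) hρ₁ hρ₂ ?_ hlog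
    · have hb := hiii k hk t ht φ hφ y
      have h2 := mul_nonneg (sub_nonneg.2 h1) (hi₂ t ht φ hφ).1
      linarith
    · have := mul_nonneg hρ₂ (Real.exp_pos (μ * r)).le
      linarith
  · have hc : 0 ≤ ρ₂ + (1 - ρ₁) * κ := add_nonneg hρ₂ (mul_nonneg (by linarith) hκ.le)
    -- Here `V₂ = ρ₁ V₂ + (1 - ρ₁) V₂`, and the excess `(1 - ρ₁) V₂` is charged to the window
    -- supremum through `κ`.
    refine h.uniformlyIISS hf (ρ := ρ₁) (c := ρ₂ + (1 - ρ₁) * κ) (fun k hk t ht φ hφ y => ?_) hρ₁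
      hc ?_ hlog
    · have hb := hiii k hk t ht φ hφ y
      have h2 := mul_le_mul_of_nonneg_left (hVκ t ht φ hφ) (sub_nonneg.2 h1.le)
      linarith
    · have h2 := le_mul_of_one_le_right hc hexp
      have h3 := mul_nonneg (sub_nonneg.2 h1.le) hκ.le
      linarith
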